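/- Let $n \ge 1$, $p > 1$, and let $\phi : \mathbb{R}^n \to [0,\infty)$ be bounded, continuous and not identically zero. For $\alpha, r > 0$ put $$D(\alpha; r) = \sup_{x \in \mathbb{R}^n} \frac{\operatorname{mes}\bigl(B(x,r) \cap \{y : \phi(y) \ge \alpha\}\bigr)}{\operatorname{mes}\bigl(B(x,r)\bigr)}, \qquad \overline{D}(\alpha) = \limsup_{r \to +\infty} D(\alpha; r),$$ where $\operatorname{mes}$ is Lebesgue measure and $B(x,r)$ is the ball of radius $r$ centred at $x$. Consider the Cauchy problem $$u_t = \Delta u + |u|^{p-1}u \ \text{ in } \mathbb{R}^n \times (0,T), \qquad u(x,0) = \phi(x) \ \text{ on } \mathbb{R}^n .$$ A solution on $[0,T)$ is a function that is continuous on $\mathbb{R}^n \times [0,T)$, of class $C^{2,1}$ on $\mathbb{R}^n \times (0,T)$, satisfies the problem pointwise, and is bounded on $\mathbb{R}^n \times [0,T']$ for every $T' < T$. Suppose that $\alpha > 0$ satisfies $\overline{D}(\alpha) > 0$. Then the solution blows up in finite time: there are $T^* \in (0,\infty)$ and a solution $u$ on $[0,T^*)$ which is the unique maximal solution (every solution $v$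 on an interval $[0,S)$ has $S \le T^*$ and $v = u$ on $\mathbb{R}^n \times [0,S)$), one has $$\lim_{t \to T^{*-}} \|u(\cdot,t)\|_{L^\infty(\mathbb{R}^n)} = \infty,$$ and $$T^* \le \frac{1}{p-1} \bigl(\alpha \overline{D}(\alpha)\bigr)^{1-p}.$$ -/

import Mathlib

open MeasureTheory Filter Topology Set

noncomputable section

/-- The space `ℝⁿ` with its Euclidean norm and Lebesgue measure. -/
abbrev RSpace (n : ℕ) : Type := EuclideanSpace ℝ (Fin n)

/-- `u` (written `u t x`, time first) is a classical solution on `ℝⁿ × [0, T)` of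
`u_t = Δ u + |u|^(p-1) u`, `u(·, 0) = φ`: it is continuous on `ℝⁿ × [0, T)`, of class `C^{2,1}` on
`ℝⁿ × (0, T)` (continuity of `u_t` there follows from the equation), solves the equation pointwise,
and is bounded on `ℝⁿ × [0, T']` for every `T' < T`. -/
structure IsClassicalSolution {n : ℕ} (p : ℝ) (φ : RSpace n → ℝ) (T : ℝ)
    (u : ℝ → RSpace n → ℝ) : Prop where
  continuousOn : ContinuousOn (fun z : ℝ × RSpace n => u z.1 z.2) (Ico 0 T ×ˢ univ)
  initial : ∀ x, u 0 x = φ x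
  contDiff : ∀ t ∈ Ioo 0 T, ContDiff ℝ 2 (u t)
  continuousOn_fderiv :
    ContinuousOn (fun z : ℝ × RSpace n => fderiv ℝ (u z.1) z.2) (Ioo 0 T ×ˢ univ)
  continuousOn_fderiv_two :
    ContinuousOn (fun z : ℝ × RSpace n => iteratedFDeriv ℝ 2 (u z.1) z.2) (Ioo 0 T ×ˢ univ)
  equation : ∀ t ∈ Ioo 0 T, ∀ x, HasDerivAt (fun s => u s x)
    (Laplacian.laplacian (u t) x + |u t x| ^ (p - 1) * u t x) t
  bounded : ∀ T' < T, ∃ M : ℝ, ∀ t ∈ Icc 0 T', ∀ x, |u t x| ≤ M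

/-- `D(α; r) = sup_x mes(B(x,r) ∩ {φ ≥ α}) / mes(B(x,r))`; the quotients lie in `[0, 1]`. -/
def density {n : ℕ} (φ : RSpace n → ℝ) (α r : ℝ) : ℝ :=
  ⨆ x : RSpace n, volume.real (Metric.ball x r ∩ {y | α ≤ φ y}) / volume.real (Metric.ball x r)

/-- The upper density at infinity, `limsup_{r → ∞} D(α; r)`. -/
def upperDensity {n : ℕ} (φ : RSpace n → ℝ) (α : ℝ) : ℝ :=
  limsup (fun r : ℝ => density φ α r) atTop

end

/-! Write `S(t)` for the heat semigroup, so that `S(t)g(x)` is the mean of `g(x + √(2t) Z)` with `Z`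
standard Gaussian. For a nonnegative solution `u`, fix `x` and a time `τ` inside its interval of
existence, and put `H(t) = S(τ - t)u(t)(x)`. Differentiation cancels the Laplacians and leaves `H' =
S(τ - t)(u^p)(x)`, which is at least `H^p` by Jensen. Integrating `(H^(1-p))' ≤ -(p-1)` gives
`(p-1)τ ≤ (S(τ)φ(x))^(1-p)` wherever `S(τ)φ(x) > 0` (`mul_le_heat_rpow`).

On the other hand, the supremum of `S(τ)φ` is at least `α` times the upper density for every `τ`
(`mul_upperDensity_le_of_heat_le`): average `S(τ)φ` over a huge ball, where diffusion at the fixed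
scale `√(2τ)` only produces a boundary effect. The two bounds together limit every life span.

The rest is the Cauchy theory. A contraction argument gives mild solutions on a time that depends
only on the sup norm of the data (`exists_isMildSolution`). Gaussian smoothing makes them classical
(`IsMildSolution.isClassicalSolution`). A maximum principle yields comparison, hence uniqueness and
positivity. Solutions can then be glued into a maximal one, and its sup norm must tend to infinity,
since otherwise a restart close to the final time would extend it. -/

open ProbabilityTheory

/-! ### The standard Gaussian measure: moments, translation, sums, second moments. -/

section Gaussian

variable {E : Type*} [NormedAddCommGroup E] [InnerProductSpace ℝ E] [FiniteDimensional ℝ E]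
  [MeasurableSpace E] [BorelSpace E]
  {W : Type*} [NormedAddCommGroup W] [NormedSpace ℝ W]

/-- Fernique's theorem gives some integrable `exp (C‖z‖²)`, and completing the square bounds `a‖z‖`
by `C‖z‖²` plus a constant. This is the majorant for differentiating exponential weights. -/
lemma integrable_exp_mul_norm_stdGaussian (a : ℝ) :
    Integrable (fun z : E => Real.exp (a * ‖z‖)) (stdGaussian E) := by
  obtain ⟨C, hC, hint⟩ := IsGaussian.exists_integrable_exp_sq (stdGaussian E)
  refine (hint.const_mul (Real.exp (a ^ 2 / (4 * C)))).mono'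
    (Continuous.aestronglyMeasurable (by fun_prop)) (ae_of_all _ fun z => ?_)
  rw [Real.norm_eq_abs, Real.abs_exp, ← Real.exp_add, Real.exp_le_exp]
  have : a ^ 2 / (4 * C) + C * ‖z‖ ^ 2 - a * ‖z‖ = (a - 2 * C * ‖z‖) ^ 2 / (4 * C) := by
    field_simp; ring
  have h2 : 0 ≤ (a - 2 * C * ‖z‖) ^ 2 / (4 * C) := by positivity
  linarith

lemma integrable_norm_stdGaussian : Integrable (fun z : E => ‖z‖) (stdGaussian E) :=
  (IsGaussian.integrable_id (μ := stdGaussian E)).norm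

lemma integrable_norm_sq_stdGaussian : Integrable (fun z : E => ‖z‖ ^ 2) (stdGaussian E) := by
  have := (IsGaussian.memLp_two_id (μ := stdGaussian E)).integrable_norm_pow (by norm_num)
  simpa using this

lemma stdGaussian_eq_withDensity :
    stdGaussian E = (volume : Measure E).withDensity (fun z => ENNReal.ofReal
      (((2 * Real.pi) ^ (Module.finrank ℝ E / 2 : ℝ))⁻¹ * Real.exp (-(1 / 2) * ‖z‖ ^ 2))) := by
  set c : ℝ := ((2 * Real.pi) ^ (Module.finrank ℝ E / 2 : ℝ))⁻¹ with hc
  have hcpos : 0 < c := by positivity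
  have hint : Integrable (fun z : E => Real.exp (-(1 / 2) * ‖z‖ ^ 2)) := by
    have := (GaussianFourier.integrable_cexp_neg_mul_sq_norm_add (V := E) (b := 1 / 2)
      (by norm_num) 0 0).norm
    refine this.congr (ae_of_all _ fun z => ?_)
    simp [Complex.norm_exp, ← Complex.ofReal_pow]
  have hint' := hint.const_mul c
  have : IsFiniteMeasure ((volume : Measure E).withDensity (fun z => ENNReal.ofReal
      (c * Real.exp (-(1 / 2) * ‖z‖ ^ 2)))) := isFiniteMeasure_withDensity_ofReal hint'.2
  refine Measure.ext_of_charFun ?_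
  ext t
  rw [charFun_stdGaussian, charFun_apply, integral_withDensity_eq_integral_toReal_smul
    (by fun_prop) (by simp)]
  have h1 : ∀ z : E, (ENNReal.ofReal (c * Real.exp (-(1 / 2) * ‖z‖ ^ 2))).toReal •
      Complex.exp (inner ℝ z t * Complex.I) =
      (c : ℂ) * Complex.exp (-(1 / 2 : ℂ) * ‖z‖ ^ 2 + Complex.I * inner ℝ t z) := by
    intro z
    rw [ENNReal.toReal_ofReal (by positivity), Complex.real_smul, Complex.exp_add,
      real_inner_comm]
    push_cast
    ring_nf
  simp_rw [h1]
  rw [integral_const_mul, GaussianFourier.integral_cexp_neg_mul_sq_norm_add (by norm_num)]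
  have h2 : ((Real.pi : ℂ) / (1 / 2)) ^ ((Module.finrank ℝ E : ℂ) / 2) =
      (((2 * Real.pi) ^ (Module.finrank ℝ E / 2 : ℝ) : ℝ) : ℂ) := by
    rw [Complex.ofReal_cpow (by positivity)]
    push_cast
    congr 1
    ring
  rw [h2, ← mul_assoc, ← Complex.ofReal_mul, hc, inv_mul_cancel₀ (by positivity)]
  simp
  ring_nf

/-- The Cameron–Martin formula: a translation moves from the function to the weight, so averages of
merely continuous functions can be differentiated. -/
lemma integral_stdGaussian_add (ψ : E → W) (h : E) :
    ∫ z, ψ (z + h) ∂(stdGaussian E) =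
      ∫ z, Real.exp (inner ℝ h z - ‖h‖ ^ 2 / 2) • ψ z ∂(stdGaussian E) := by
  rw [stdGaussian_eq_withDensity, integral_withDensity_eq_integral_toReal_smul
    (by fun_prop) (by simp), integral_withDensity_eq_integral_toReal_smul
    (by fun_prop) (by simp)]
  conv_rhs => rw [← integral_add_right_eq_self (μ := (volume : Measure E)) _ h]
  congr 1
  ext z
  rw [ENNReal.toReal_ofReal (by positivity), ENNReal.toReal_ofReal (by positivity), smul_smul,
    mul_assoc, ← Real.exp_add]
  congr 3
  rw [norm_add_sq_real, inner_add_right, real_inner_self_eq_norm_sq, real_inner_comm]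
  ring

/-- Variances of independent Gaussians add, as characteristic functions multiply. This is the source
of the semigroup law. -/
lemma map_prod_stdGaussian {σ τ ρ : ℝ} (h : ρ ^ 2 = σ ^ 2 + τ ^ 2) :
    ((stdGaussian E).prod (stdGaussian E)).map (fun q : E × E => σ • q.1 + τ • q.2) =
      (stdGaussian E).map (fun z => ρ • z) := by
  have : IsFiniteMeasure (((stdGaussian E).prod (stdGaussian E)).map
    (fun q : E × E => σ • q.1 + τ • q.2)) := inferInstance
  refine Measure.ext_of_charFun ?_
  ext t
  rw [charFun_apply, charFun_apply, integral_map (by fun_prop)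
    (Continuous.aestronglyMeasurable (by fun_prop)), integral_map (by fun_prop)
    (Continuous.aestronglyMeasurable (by fun_prop))]
  have key : ∀ a : ℝ, ∫ z, Complex.exp ((inner ℝ (a • z) t : ℝ) * Complex.I) ∂(stdGaussian E) =
      Complex.exp (-(a ^ 2 * ‖t‖ ^ 2 / 2 : ℝ)) := by
    intro a
    have := charFun_stdGaussian (E := E) (a • t)
    rw [charFun_apply] at this
    simp_rw [real_inner_smul_left]
    simp_rw [real_inner_smul_right] at this
    rw [this, norm_smul, Real.norm_eq_abs]
    rw [← Complex.ofReal_pow, mul_pow, sq_abs]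
    congr 1
    push_cast
    ring
  rw [key]
  simp_rw [inner_add_left, Complex.ofReal_add, add_mul, Complex.exp_add]
  rw [integral_prod_mul (fun z : E => Complex.exp ((inner ℝ (σ • z) t : ℝ) * Complex.I))
    (fun z : E => Complex.exp ((inner ℝ (τ • z) t : ℝ) * Complex.I)), key, key,
    ← Complex.exp_add, h]
  congr 1
  push_cast
  ring

/-- The covariance is the identity, so a quadratic form averages to its trace. This is how the
Laplacian arises from Gaussian averages. -/
lemma integral_bilin_stdGaussian {ι : Type*} [Fintype ι] (b : OrthonormalBasis ι ℝ E)
    (B : E →L[ℝ] E →L[ℝ] ℝ) :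
    ∫ z, B z z ∂(stdGaussian E) = ∑ i, B (b i) (b i) := by
  classical
  have h1 : ∀ z : E, B z z = ∑ i, ∑ j, (inner ℝ (b i) z * inner ℝ (b j) z) * B (b i) (b j) := by
    intro z
    conv_lhs => rw [← b.sum_repr' z]
    simp only [map_sum, map_smul, sum_apply, smul_apply,
      smul_eq_mul, Finset.mul_sum]
    rw [Finset.sum_comm]
    refine Finset.sum_congr rfl fun i _ => Finset.sum_congr rfl fun j _ => ?_
    ring
  have hint : ∀ i j, Integrable (fun z => inner ℝ (b i) z * inner ℝ (b j) z) (stdGaussian E) := by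
    intro i j
    refine integrable_norm_sq_stdGaussian.mono' (Continuous.aestronglyMeasurable (by fun_prop))
      (ae_of_all _ fun z => ?_)
    rw [norm_mul, sq]
    gcongr
    · simpa using norm_inner_le_norm (𝕜 := ℝ) (b i) z
    · simpa using norm_inner_le_norm (𝕜 := ℝ) (b j) z
  have h2 : ∀ i j, ∫ z, inner ℝ (b i) z * inner ℝ (b j) z ∂(stdGaussian E) =
      inner ℝ (b i) (b j) := by
    intro i j
    have := covarianceBilin_apply (IsGaussian.memLp_two_id (μ := stdGaussian E)) (b i) (b j)
    rw [covarianceBilin_stdGaussian] at this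
    rw [innerSL_apply_apply] at this
    simpa using this.symm
  simp_rw [h1]
  rw [integral_finsetSum _ fun i _ => integrable_finsetSum _ fun j _ => (hint i j).mul_const _]
  refine Finset.sum_congr rfl fun i _ => ?_
  rw [integral_finsetSum _ fun j _ => (hint i j).mul_const _]
  simp_rw [integral_mul_const, h2]
  simp [b.inner_eq_ite]

end Gaussian

/-! ### The heat semigroup and its gradient. -/

section Heat

set_option linter.unusedSectionVars false

variable {E : Type*} [NormedAddCommGroup E] [InnerProductSpace ℝ E] [FiniteDimensional ℝ E]
  [MeasurableSpace E] [BorelSpace E]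
  {W : Type*} [NormedAddCommGroup W] [NormedSpace ℝ W]

/-- Gaussian average of `g` around `x` at length scale `σ`: the heat semigroup at time `σ² / 2`. -/
noncomputable def heat (σ : ℝ) (g : E → W) (x : E) : W :=
  ∫ z, g (x + σ • z) ∂(stdGaussian E)

/-- The derivative of `heat σ g`, with the derivative put on the Gaussian weight. -/
noncomputable def heatGrad (σ : ℝ) (g : E → W) (x : E) : E →L[ℝ] W :=
  σ⁻¹ • ∫ z, (innerSL ℝ z).smulRight (g (x + σ • z)) ∂(stdGaussian E)

lemma norm_heat_le {g : E → W} {C : ℝ} (hg : ∀ x, ‖g x‖ ≤ C) (σ : ℝ) (x : E) :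
    ‖heat σ g x‖ ≤ C := by
  have := norm_integral_le_of_norm_le_const (μ := stdGaussian E)
    (ae_of_all _ fun z => hg (x + σ • z))
  simpa [heat] using this

lemma heat_zero [CompleteSpace W] (g : E → W) (x : E) : heat 0 g x = g x := by
  simp [heat]

lemma integrable_heat {g : E → W} {C : ℝ} (hgc : Continuous g) (hg : ∀ x, ‖g x‖ ≤ C)
    (σ : ℝ) (x : E) : Integrable (fun z => g (x + σ • z)) (stdGaussian E) :=
  Integrable.of_bound (Continuous.aestronglyMeasurable (by fun_prop)) C
    (ae_of_all _ fun z => hg _)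

lemma norm_innerSL_smulRight (z : E) (w : W) : ‖(innerSL ℝ z).smulRight w‖ = ‖z‖ * ‖w‖ := by
  rw [ContinuousLinearMap.norm_smulRight_apply, innerSL_apply_norm]

/-- The smoothing estimate: since `σ = √(2t)`, one gradient costs `t^(-1/2)`, which is integrable in
time. -/
lemma norm_heatGrad_le {g : E → W} {C : ℝ} (hg : ∀ x, ‖g x‖ ≤ C) (σ : ℝ) (x : E) :
    ‖heatGrad σ g x‖ ≤ |σ|⁻¹ * ((∫ z, ‖z‖ ∂(stdGaussian E)) * C) := by
  rw [heatGrad, norm_smul, norm_inv, Real.norm_eq_abs]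
  gcongr
  rw [← integral_mul_const]
  refine norm_integral_le_of_norm_le (integrable_norm_stdGaussian.mul_const C)
    (ae_of_all _ fun z => ?_)
  rw [norm_innerSL_smulRight]
  gcongr
  exact hg _

section Param

variable {X : Type*} [TopologicalSpace X] [FirstCountableTopology X]
  {g : X → E → W} {ς : X → ℝ} {y : X → E} {q₀ : X} {C : ℝ}

/-- The hypotheses on `g` are local in the parameter, so that sources controlled only on an open
time interval are covered. -/
lemma continuousAt_heat (hς : ContinuousAt ς q₀) (hy : ContinuousAt y q₀)
    (hg : ∀ z, ContinuousAt (fun q : X × E => g q.1 q.2) (q₀, z))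
    (hb : ∀ᶠ q in 𝓝 q₀, ∀ z, ‖g q z‖ ≤ C) (hc : ∀ᶠ q in 𝓝 q₀, Continuous (g q)) :
    ContinuousAt (fun q => heat (ς q) (g q) (y q)) q₀ := by
  unfold heat
  refine continuousAt_of_dominated (bound := fun _ => C) ?_ ?_ (integrable_const C) ?_
  · filter_upwards [hc] with q hq
    exact Continuous.aestronglyMeasurable (by fun_prop)
  · filter_upwards [hb] with q hq
    exact ae_of_all _ fun z => hq _
  · refine ae_of_all _ fun z => ?_
    have h1 : ContinuousAt (fun q => (q, y q + ς q • z)) q₀ := by fun_prop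
    exact ContinuousAt.comp (g := fun q : X × E => g q.1 q.2) (x := q₀) (hg _) h1

lemma continuousAt_heatGrad (hς : ContinuousAt ς q₀) (hy : ContinuousAt y q₀) (h0 : ς q₀ ≠ 0)
    (hg : ∀ z, ContinuousAt (fun q : X × E => g q.1 q.2) (q₀, z))
    (hb : ∀ᶠ q in 𝓝 q₀, ∀ z, ‖g q z‖ ≤ C) (hc : ∀ᶠ q in 𝓝 q₀, Continuous (g q)) :
    ContinuousAt (fun q => heatGrad (ς q) (g q) (y q)) q₀ := by
  unfold heatGrad
  refine (hς.inv₀ h0).smul ?_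
  refine continuousAt_of_dominated (bound := fun z => ‖z‖ * C) ?_ ?_
    (integrable_norm_stdGaussian.mul_const C) ?_
  · filter_upwards [hc] with q hq
    exact Continuous.aestronglyMeasurable (by fun_prop)
  · filter_upwards [hb] with q hq
    refine ae_of_all _ fun z => ?_
    rw [norm_innerSL_smulRight]
    gcongr
    exact hq _
  · refine ae_of_all _ fun z => ?_
    have h1 : ContinuousAt (fun q => (q, y q + ς q • z)) q₀ := by fun_prop
    have h2 : ContinuousAt (fun q => g q (y q + ς q • z)) q₀ :=
      ContinuousAt.comp (g := fun q : X × E => g q.1 q.2) (x := q₀) (hg _) h1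
    exact (ContinuousLinearMap.smulRightL ℝ E W (innerSL ℝ z)).continuous.continuousAt.comp h2

lemma continuous_heat_param (hς : Continuous ς) (hy : Continuous y)
    (hg : Continuous (fun q : X × E => g q.1 q.2)) (hb : ∀ q z, ‖g q z‖ ≤ C) :
    Continuous (fun q => heat (ς q) (g q) (y q)) :=
  continuous_iff_continuousAt.2 fun _ => continuousAt_heat hς.continuousAt hy.continuousAt
    (fun _ => hg.continuousAt) (Eventually.of_forall hb)
    (Eventually.of_forall fun q => hg.comp (Continuous.prodMk_right q))

end Param

lemma continuous_heat {g : E → W} {C : ℝ} (hgc : Continuous g) (hg : ∀ x, ‖g x‖ ≤ C) (σ : ℝ) :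
    Continuous (heat σ g) :=
  continuous_heat_param (X := E) (g := fun _ => g) continuous_const continuous_id
    (by fun_prop) (fun _ => hg)

lemma continuous_heatGrad {g : E → W} {C : ℝ} (hgc : Continuous g) (hg : ∀ x, ‖g x‖ ≤ C) {σ : ℝ}
    (hσ : σ ≠ 0) : Continuous (heatGrad σ g) :=
  continuous_iff_continuousAt.2 fun _ => continuousAt_heatGrad (g := fun _ => g)
    (ς := fun _ => σ) (y := id) continuousAt_const continuousAt_id hσ
    (fun _ => by fun_prop) (Eventually.of_forall fun _ => hg)
    (Eventually.of_forall fun _ => hgc)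

lemma heat_add_eq {σ : ℝ} (hσ : σ ≠ 0) (g : E → W) (x h : E) :
    heat σ g (x + h) = ∫ z, Real.exp (inner ℝ (σ⁻¹ • h) z - ‖σ⁻¹ • h‖ ^ 2 / 2) •
      g (x + σ • z) ∂(stdGaussian E) := by
  rw [← integral_stdGaussian_add (fun z => g (x + σ • z)), heat]
  congr 1
  ext z
  rw [smul_add, smul_smul, mul_inv_cancel₀ hσ, one_smul, add_assoc, add_comm h]

/-- By `heat_add_eq` the increment `h` appears only in the exponential weight, which is
differentiated under the integral at `h = 0`. For `‖h‖ < 1` everything is dominated by a multiple of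
`exp ((a + 1)‖z‖)`. -/
lemma hasFDerivAt_heat {g : E → W} {C : ℝ} (hgc : Continuous g) (hg : ∀ x, ‖g x‖ ≤ C) {σ : ℝ}
    (hσ : σ ≠ 0) (x : E) : HasFDerivAt (heat σ g) (heatGrad σ g x) x := by
  have hC : 0 ≤ C := (norm_nonneg _).trans (hg 0)
  set a : ℝ := |σ⁻¹| with ha
  have ha0 : 0 ≤ a := abs_nonneg _
  let F : E → E → W := fun h z =>
    Real.exp (inner ℝ (σ⁻¹ • h) z - ‖σ⁻¹ • h‖ ^ 2 / 2) • g (x + σ • z)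
  let F' : E → E → (E →L[ℝ] W) := fun h z =>
    (Real.exp (inner ℝ (σ⁻¹ • h) z - ‖σ⁻¹ • h‖ ^ 2 / 2) •
      (σ⁻¹ • innerSL ℝ z - (σ⁻¹) ^ 2 • innerSL ℝ h)).smulRight (g (x + σ • z))
  have hexp : ∀ h ∈ Metric.ball (0 : E) 1, ∀ z : E,
      Real.exp (inner ℝ (σ⁻¹ • h) z - ‖σ⁻¹ • h‖ ^ 2 / 2) ≤ Real.exp (a * ‖z‖) := by
    intro h hh z
    rw [Real.exp_le_exp]
    have h1 : inner ℝ (σ⁻¹ • h) z ≤ ‖σ⁻¹ • h‖ * ‖z‖ := real_inner_le_norm _ _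
    have h2 : ‖σ⁻¹ • h‖ ≤ a := by
      rw [norm_smul, Real.norm_eq_abs]
      have : ‖h‖ ≤ 1 := by simpa using (mem_ball_zero_iff.1 hh).le
      nlinarith
    have h3 : ‖σ⁻¹ • h‖ * ‖z‖ ≤ a * ‖z‖ := by gcongr
    have h4 : 0 ≤ ‖σ⁻¹ • h‖ ^ 2 / 2 := by positivity
    linarith
  have key := hasFDerivAt_integral_of_dominated_of_fderiv_le (μ := stdGaussian E) (𝕜 := ℝ)
    (F := F) (F' := F') (x₀ := (0 : E)) (s := Metric.ball 0 1)
    (bound := fun z => ((a + a ^ 2) * C) * Real.exp ((a + 1) * ‖z‖))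
    (Metric.ball_mem_nhds _ one_pos) ?_ ?_ ?_ ?_ ?_ ?_
  · have h1 : (fun h => heat σ g (x + h)) = fun h => ∫ z, F h z ∂(stdGaussian E) :=
      funext fun h => heat_add_eq hσ g x h
    have h2 : (∫ z, F' 0 z ∂(stdGaussian E)) = heatGrad σ g x := by
      rw [heatGrad, ← integral_smul]
      congr 1
      ext z v
      simp [F', mul_smul]
    rw [← h1, h2] at key
    simpa using (hasFDerivAt_comp_add_left x).1 key
  · refine Eventually.of_forall fun h => Continuous.aestronglyMeasurable ?_
    fun_prop
  · have : F 0 = fun z => g (x + σ • z) := by ext z; simp [F]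
    rw [this]
    exact integrable_heat hgc hg σ x
  · have : SecondCountableTopologyEither E (E →L[ℝ] W) := ⟨Or.inl inferInstance⟩
    have hF' : Continuous (F' 0) := by
      simp only [F']
      fun_prop
    exact hF'.aestronglyMeasurable
  · refine ae_of_all _ fun z h hh => ?_
    simp only [F']
    rw [ContinuousLinearMap.norm_smulRight_apply, norm_smul, Real.norm_eq_abs, Real.abs_exp]
    have h1 : ‖h‖ ≤ 1 := by simpa using (mem_ball_zero_iff.1 hh).le
    have h2 : ‖σ⁻¹ • innerSL ℝ z - (σ⁻¹) ^ 2 • innerSL ℝ h‖ ≤ (a + a ^ 2) * Real.exp (‖z‖) := by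
      have e1 : ‖σ⁻¹ • innerSL ℝ z‖ = a * ‖z‖ := by
        rw [norm_smul, innerSL_apply_norm, Real.norm_eq_abs]
      have e2 : ‖(σ⁻¹) ^ 2 • innerSL ℝ h‖ = a ^ 2 * ‖h‖ := by
        rw [norm_smul, innerSL_apply_norm, Real.norm_eq_abs, abs_pow]
      refine (norm_sub_le _ _).trans ?_
      rw [e1, e2]
      have e3 : ‖z‖ + 1 ≤ Real.exp ‖z‖ := Real.add_one_le_exp _
      have e4 : 1 ≤ Real.exp ‖z‖ := Real.one_le_exp (norm_nonneg _)
      have e5 : a * ‖z‖ ≤ a * Real.exp ‖z‖ := by gcongr; linarith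
      have e6 : a ^ 2 * ‖h‖ ≤ a ^ 2 * Real.exp ‖z‖ := by gcongr; linarith
      linarith
    calc _ ≤ Real.exp (a * ‖z‖) * ((a + a ^ 2) * Real.exp (‖z‖)) * C := by
            exact mul_le_mul (mul_le_mul (hexp h hh z) h2 (norm_nonneg _) (Real.exp_nonneg _))
              (hg _) (norm_nonneg _) (by positivity)
      _ = _ := by rw [add_mul a 1, one_mul, Real.exp_add]; ring
  · exact (integrable_exp_mul_norm_stdGaussian _).const_mul _
  · refine ae_of_all _ fun z h _ => ?_
    have h1 : HasFDerivAt (fun h : E => inner ℝ (σ⁻¹ • h) z - ‖σ⁻¹ • h‖ ^ 2 / 2)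
        (σ⁻¹ • innerSL ℝ z - (σ⁻¹) ^ 2 • innerSL ℝ h) h := by
      have e1 : HasFDerivAt (fun h : E => σ⁻¹ * inner ℝ z h) (σ⁻¹ • innerSL ℝ z) h :=
        ((innerSL ℝ z).hasFDerivAt).const_mul σ⁻¹
      have e2 : HasFDerivAt (fun h : E => (σ⁻¹) ^ 2 / 2 * ‖h‖ ^ 2)
          (((σ⁻¹) ^ 2 / 2) • (2 • innerSL ℝ h)) h :=
        (hasStrictFDerivAt_norm_sq h).hasFDerivAt.const_mul _
      refine ((e1.sub e2).congr_fderiv ?_).congr_of_eventuallyEq (Eventually.of_forall fun h => ?_)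
      · ext v
        simp
        ring
      · simp only [Pi.sub_apply]
        rw [real_inner_smul_left, real_inner_comm, norm_smul, mul_pow, Real.norm_eq_abs, sq_abs]
        ring
    exact (h1.exp).smul_const _

/-- Here the derivative falls on `g` instead of the kernel. Comparing both forms by uniqueness of
derivatives shows that gradient and semigroup commute. -/
lemma hasFDerivAt_heat_of_hasFDerivAt {g : E → W} {g' : E → E →L[ℝ] W} {C C' : ℝ}
    (hd : ∀ x, HasFDerivAt g (g' x) x) (hg'c : Continuous g') (hg : ∀ x, ‖g x‖ ≤ C)
    (hg' : ∀ x, ‖g' x‖ ≤ C') (σ : ℝ) (x : E) :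
    HasFDerivAt (heat σ g) (heat σ g' x) x := by
  have hgc : Continuous g := continuous_iff_continuousAt.2 fun x => (hd x).continuousAt
  refine hasFDerivAt_integral_of_dominated_of_fderiv_le (μ := stdGaussian E) (𝕜 := ℝ)
    (F := fun x z => g (x + σ • z)) (F' := fun x z => g' (x + σ • z)) (bound := fun _ => C')
    univ_mem ?_ ?_ ?_ ?_ ?_ ?_
  · exact Eventually.of_forall fun y => Continuous.aestronglyMeasurable (by fun_prop)
  · exact integrable_heat hgc hg σ x
  · exact Continuous.aestronglyMeasurable (by fun_prop)
  · exact ae_of_all _ fun z y _ => hg' _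
  · exact integrable_const _
  · exact ae_of_all _ fun z y _ => (hasFDerivAt_comp_add_right (σ • z)).2 (hd (y + σ • z))

lemma heat_heat {g : E → W} {C : ℝ} (hgc : Continuous g) (hg : ∀ x, ‖g x‖ ≤ C) {σ τ ρ : ℝ}
    (h : ρ ^ 2 = σ ^ 2 + τ ^ 2) (x : E) : heat σ (heat τ g) x = heat ρ g x := by
  unfold heat
  have hint : Integrable (fun q : E × E => g (x + (σ • q.1 + τ • q.2)))
      ((stdGaussian E).prod (stdGaussian E)) :=
    Integrable.of_bound (Continuous.aestronglyMeasurable (by fun_prop)) C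
      (ae_of_all _ fun z => hg _)
  simp_rw [add_assoc]
  rw [integral_integral (f := fun z w => g (x + (σ • z + τ • w))) hint,
    ← integral_map (φ := fun q : E × E => σ • q.1 + τ • q.2) (f := fun v => g (x + v))
      (by fun_prop) (Continuous.aestronglyMeasurable (by fun_prop)), map_prod_stdGaussian h,
    integral_map (by fun_prop) (Continuous.aestronglyMeasurable (by fun_prop))]

/-- Jensen's inequality for the Gaussian average. -/
lemma rpow_heat_le {g : E → ℝ} {C p : ℝ} (hp : 1 ≤ p) (hgc : Continuous g) (h0 : ∀ x, 0 ≤ g x)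
    (hg : ∀ x, g x ≤ C) (σ : ℝ) (x : E) :
    heat σ g x ^ p ≤ heat σ (fun y => g y ^ p) x := by
  have hp0 : 0 ≤ p := by linarith
  refine (convexOn_rpow hp).map_integral_le (μ := stdGaussian E)
    (f := fun z => g (x + σ • z)) (continuousOn_id.rpow_const fun _ _ => Or.inr hp0) isClosed_Ici
    (ae_of_all _ fun z => h0 _) ?_ ?_
  · exact integrable_heat hgc (fun y => by rw [Real.norm_of_nonneg (h0 y)]; exact hg y) σ x
  · refine integrable_heat (g := fun y => g y ^ p) (C := C ^ p)
      (hgc.rpow_const fun _ => Or.inr hp0) (fun y => ?_) σ x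
    rw [Real.norm_of_nonneg (Real.rpow_nonneg (h0 y) _)]
    exact Real.rpow_le_rpow (h0 y) (hg y) hp0

end Heat

/-! ### The Laplacian as generator of the heat semigroup. -/

section HeatGenerator

variable {E : Type*} [NormedAddCommGroup E] [InnerProductSpace ℝ E]

/-- Second-order Taylor expansion with Peano remainder: the derivative of the remainder `k` along
the ray is `o(s)`, and the mean value inequality makes `k` itself `o(s²)`. -/
lemma tendsto_second_order_quotient {g : E → ℝ} {g' : E → E →L[ℝ] ℝ} {H : E →L[ℝ] E →L[ℝ] ℝ} {x : E}
    (hd : ∀ y, HasFDerivAt g (g' y) y) (hd' : HasFDerivAt g' H x) (z : E) :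
    Tendsto (fun s : ℝ => (s ^ 2)⁻¹ * (g (x + s • z) - g x - s * g' x z)) (𝓝[>] 0)
      (𝓝 (H z z / 2)) := by
  let k : ℝ → ℝ := fun s => g (x + s • z) - g x - s * g' x z - s ^ 2 * (H z z / 2)
  have hk : ∀ s, HasDerivAt k ((g' (x + s • z) - g' x - H (s • z)) z) s := by
    intro s
    have h1 : HasDerivAt (fun s : ℝ => x + s • z) z s := by
      simpa using ((hasDerivAt_id s).smul_const z).const_add x
    have h2 := (hd (x + s • z)).comp_hasDerivAt s h1
    have h3 := ((h2.sub_const (g x)).sub ((hasDerivAt_id s).mul_const (g' x z))).sub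
      (((hasDerivAt_id s).pow 2).mul_const (H z z / 2))
    refine h3.congr_deriv ?_
    simp
    ring
  have hlo : (fun s : ℝ => g' (x + s • z) - g' x - H (s • z)) =o[𝓝 0] fun s : ℝ => s • z := by
    have := hd'.isLittleO
    have h1 : Tendsto (fun s : ℝ => x + s • z) (𝓝 0) (𝓝 x) := by
      have : Continuous (fun s : ℝ => x + s • z) := by fun_prop
      simpa using this.tendsto 0
    simpa [Function.comp_def] using this.comp_tendsto h1
  have hk0 : k =o[𝓝[>] (0 : ℝ)] fun s => s ^ 2 := by
    rw [Asymptotics.isLittleO_iff]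
    intro ε hε
    -- The denominator absorbs two factors `‖z‖`, one from the increment `r • z` and one from
    -- evaluation at `z`.
    have hε' : 0 < ε / (‖z‖ ^ 2 + 1) := by positivity
    have h1 := (Asymptotics.isLittleO_iff.1 hlo) hε'
    obtain ⟨δ, hδ, hball⟩ := Metric.eventually_nhds_iff.1 h1
    filter_upwards [Ioo_mem_nhdsGT hδ] with s hs
    have hb : ∀ r ∈ Icc (0 : ℝ) s, ‖(g' (x + r • z) - g' x - H (r • z)) z‖ ≤ ε * s := by
      intro r hr
      have hr' : dist r 0 < δ := by
        rw [Real.dist_eq, sub_zero, abs_of_nonneg hr.1]; exact hr.2.trans_lt hs.2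
      have h2 := hball hr'
      refine (ContinuousLinearMap.le_opNorm _ _).trans ?_
      calc _ ≤ (ε / (‖z‖ ^ 2 + 1) * ‖r • z‖) * ‖z‖ := by gcongr
        _ = ε * r * (‖z‖ ^ 2 / (‖z‖ ^ 2 + 1)) := by
            rw [norm_smul, Real.norm_of_nonneg hr.1]; ring
        _ ≤ ε * s * 1 := by
            have : ‖z‖ ^ 2 / (‖z‖ ^ 2 + 1) ≤ 1 := by
              rw [div_le_one (by positivity)]; linarith
            have h3 := hr.1
            have h4 := hr.2
            have h5 : 0 ≤ ε * s := mul_nonneg hε.le (h3.trans h4)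
            gcongr
        _ = _ := mul_one _
    have h2 := (convex_Icc (0 : ℝ) s).norm_image_sub_le_of_norm_hasDerivWithin_le
      (fun r _ => (hk r).hasDerivWithinAt) hb (left_mem_Icc.2 hs.1.le) (right_mem_Icc.2 hs.1.le)
    have hk00 : k 0 = 0 := by simp [k]
    rw [hk00, sub_zero, sub_zero] at h2
    refine h2.trans (le_of_eq ?_)
    simp only [Real.norm_eq_abs, abs_of_pos hs.1, abs_pow]
    ring
  have h1 := hk0.tendsto_div_nhds_zero.add_const (H z z / 2)
  rw [zero_add] at h1
  refine h1.congr' ?_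
  filter_upwards [self_mem_nhdsWithin] with s hs
  have : s ≠ 0 := ne_of_gt hs
  simp only [k]
  field_simp
  ring

variable [FiniteDimensional ℝ E] [MeasurableSpace E] [BorelSpace E]

/-- The first-order Taylor term has mean zero and can be subtracted for free. With `s = √(2h)` the
second-order quotient tends to `g'' x z z`, is dominated by `2 C₂ ‖z‖²`, and its limit averages to
the trace. -/
lemma tendsto_heat_sub_div {g : E → ℝ} {g' : E → E →L[ℝ] ℝ} {g'' : E → E →L[ℝ] E →L[ℝ] ℝ}
    {C₀ C₂ : ℝ} (hd : ∀ y, HasFDerivAt g (g' y) y) (hd' : ∀ y, HasFDerivAt g' (g'' y) y)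
    (h₀ : ∀ y, ‖g y‖ ≤ C₀) (h₂ : ∀ y, ‖g'' y‖ ≤ C₂) (x : E)
    {ι : Type*} [Fintype ι] (b : OrthonormalBasis ι ℝ E) :
    Tendsto (fun h : ℝ => h⁻¹ * (heat (√(2 * h)) g x - g x)) (𝓝[>] 0)
      (𝓝 (∑ i, g'' x (b i) (b i))) := by
  have hgc : Continuous g := continuous_iff_continuousAt.2 fun x => (hd x).continuousAt
  have hrem : ∀ y, ‖g (x + y) - g x - g' x y‖ ≤ C₂ * ‖y‖ ^ 2 := by
    intro y
    have hL : ∀ w ∈ Metric.closedBall x ‖y‖, ‖g' w - g' x‖ ≤ C₂ * ‖y‖ := by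
      intro w hw
      have := convex_univ.norm_image_sub_le_of_norm_hasFDerivWithin_le (f := g')
        (fun v _ => (hd' v).hasFDerivWithinAt) (fun v _ => h₂ v) (mem_univ x) (mem_univ w)
      refine this.trans ?_
      have hC : 0 ≤ C₂ := (norm_nonneg (g'' x)).trans (h₂ x)
      gcongr
      simpa [dist_eq_norm] using hw
    have := (convex_closedBall x ‖y‖).norm_image_sub_le_of_norm_hasFDerivWithin_le' (f := g)
      (fun v _ => (hd v).hasFDerivWithinAt) hL (Metric.mem_closedBall_self (norm_nonneg _))
      (y := x + y) (by simp)
    simpa [sq, mul_assoc] using this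
  rw [← integral_bilin_stdGaussian b (g'' x)]
  have heq : ∀ h : ℝ, h⁻¹ * (heat (√(2 * h)) g x - g x) = ∫ z, h⁻¹ *
      (g (x + √(2 * h) • z) - g x - √(2 * h) * g' x z) ∂(stdGaussian E) := by
    intro h
    have i1 := integrable_heat hgc h₀ (√(2 * h)) x
    have i2 : Integrable (fun z => g' x z) (stdGaussian E) := IsGaussian.integrable_dual _ _
    have i3 : Integrable (fun z => g (x + √(2 * h) • z) - g x) (stdGaussian E) :=
      i1.sub (integrable_const _)
    rw [integral_const_mul, integral_sub i3 (i2.const_mul _),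
      integral_sub i1 (integrable_const _), integral_const_mul, integral_strongDual_stdGaussian]
    simp [heat]
  simp_rw [heq]
  refine tendsto_integral_filter_of_dominated_convergence (fun z => 2 * C₂ * ‖z‖ ^ 2) ?_ ?_
    (integrable_norm_sq_stdGaussian.const_mul _) ?_
  · exact Eventually.of_forall fun h => Continuous.aestronglyMeasurable (by fun_prop)
  · filter_upwards [self_mem_nhdsWithin] with h hh
    have hh : 0 < h := hh
    refine ae_of_all _ fun z => ?_
    have h1 := hrem (√(2 * h) • z)
    rw [map_smul, smul_eq_mul] at h1
    rw [norm_mul, norm_inv, Real.norm_of_nonneg hh.le]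
    calc _ ≤ h⁻¹ * (C₂ * ‖√(2 * h) • z‖ ^ 2) := by gcongr
      _ = _ := by
        rw [norm_smul, mul_pow, Real.norm_eq_abs, sq_abs, Real.sq_sqrt (by positivity)]
        field_simp
  · refine ae_of_all _ fun z => ?_
    have h1 := tendsto_second_order_quotient hd (hd' x) z
    have h2 : Tendsto (fun h : ℝ => √(2 * h)) (𝓝[>] 0) (𝓝[>] 0) := by
      refine tendsto_nhdsWithin_iff.2 ⟨?_, ?_⟩
      · have : Continuous fun h : ℝ => √(2 * h) := by fun_prop
        have h3 := this.tendsto 0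
        simp only [mul_zero, Real.sqrt_zero] at h3
        exact h3.mono_left nhdsWithin_le_nhds
      · filter_upwards [self_mem_nhdsWithin] with h hh
        have hh : 0 < h := hh
        exact Real.sqrt_pos.2 (by positivity)
    have h3 := (h1.comp h2).const_mul 2
    rw [mul_div_cancel₀ _ (two_ne_zero)] at h3
    refine h3.congr' ?_
    filter_upwards [self_mem_nhdsWithin] with h hh
    have hh : 0 < h := hh
    simp only [Function.comp]
    rw [Real.sq_sqrt (by positivity)]
    field_simp

end HeatGenerator

/-! ### Duhamel integrals of sources with a `1/√s` singularity at time zero. -/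

section Duhamel

variable {E : Type*} [NormedAddCommGroup E] [InnerProductSpace ℝ E] [FiniteDimensional ℝ E]
  [MeasurableSpace E] [BorelSpace E]
  {W : Type*} [NormedAddCommGroup W] [NormedSpace ℝ W]

lemma integrableOn_inv_sqrt : IntegrableOn (fun θ : ℝ => (√θ)⁻¹) (Ioo 0 1) := by
  have h : IntervalIntegrable (fun θ : ℝ => θ ^ (-(1 / 2) : ℝ)) volume 0 1 :=
    intervalIntegral.intervalIntegrable_rpow' (by norm_num)
  rw [intervalIntegrable_iff_integrableOn_Ioo_of_le zero_le_one] at h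
  refine h.congr_fun (fun θ hθ => ?_) measurableSet_Ioo
  simp only
  rw [Real.rpow_neg hθ.1.le, Real.sqrt_eq_rpow]

lemma integrableOn_inv_sqrt_one_sub : IntegrableOn (fun θ : ℝ => (√(1 - θ))⁻¹) (Ioo 0 1) := by
  have h : IntervalIntegrable (fun θ : ℝ => (√θ)⁻¹) volume 0 1 :=
    (intervalIntegrable_iff_integrableOn_Ioo_of_le zero_le_one).2 integrableOn_inv_sqrt
  have := (h.comp_sub_left 1).symm
  simp only [sub_zero, sub_self] at this
  exact (intervalIntegrable_iff_integrableOn_Ioo_of_le zero_le_one).1 this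

lemma integrableOn_inv_sqrt_mul_inv_sqrt :
    IntegrableOn (fun θ : ℝ => (√(1 - θ))⁻¹ * (√θ)⁻¹) (Ioo 0 1) := by
  refine Integrable.mono' (integrableOn_inv_sqrt.add integrableOn_inv_sqrt_one_sub)
    (Measurable.aestronglyMeasurable (by fun_prop)) ?_
  filter_upwards [ae_restrict_mem measurableSet_Ioo] with θ hθ
  have h1 : 0 < √θ := Real.sqrt_pos.2 hθ.1
  have h2 : 0 < √(1 - θ) := Real.sqrt_pos.2 (by linarith [hθ.2])
  have h3 : √θ ^ 2 = θ := Real.sq_sqrt hθ.1.le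
  have h4 : √(1 - θ) ^ 2 = 1 - θ := Real.sq_sqrt (by linarith [hθ.2])
  -- This bounds the product of the two singular weights by their sum, each of which has a single
  -- integrable endpoint singularity.
  have h5 : 1 ≤ √θ + √(1 - θ) := by nlinarith
  rw [Real.norm_of_nonneg (by positivity)]
  simp only [Pi.add_apply]
  rw [← mul_inv, inv_add_inv h1.ne' h2.ne', inv_eq_one_div, mul_comm]
  gcongr

/-- `F` is continuous on `(0, τ) × E` and bounded by `C / √s`. -/
structure SqrtSingular (F : ℝ → E → W) (τ C : ℝ) : Prop where
  cont : ContinuousOn (fun z : ℝ × E => F z.1 z.2) (Ioo 0 τ ×ˢ univ)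
  bound : ∀ s ∈ Ioo 0 τ, ∀ x, ‖F s x‖ ≤ C * (√s)⁻¹

/-- `∫₀ᵗ S(t - s) F(s) ds`, rescaled to the unit interval. -/
noncomputable def duhamel (F : ℝ → E → W) (t : ℝ) (x : E) : W :=
  t • ∫ θ in Ioo (0 : ℝ) 1, heat (√(2 * (t * (1 - θ)))) (F (t * θ)) x

/-- `∫₀ᵗ ∇S(t - s) F(s) ds`, rescaled to the unit interval. -/
noncomputable def duhamelGrad (F : ℝ → E → W) (t : ℝ) (x : E) : E →L[ℝ] W :=
  t • ∫ θ in Ioo (0 : ℝ) 1, heatGrad (√(2 * (t * (1 - θ)))) (F (t * θ)) x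

namespace SqrtSingular

set_option linter.unusedSectionVars false

variable {F : ℝ → E → W} {τ C : ℝ}

lemma continuousAt (h : SqrtSingular F τ C) {s : ℝ} (hs : s ∈ Ioo 0 τ) (x : E) :
    ContinuousAt (fun z : ℝ × E => F z.1 z.2) (s, x) :=
  h.cont.continuousAt ((isOpen_Ioo.prod isOpen_univ).mem_nhds ⟨hs, mem_univ _⟩)

lemma continuous (h : SqrtSingular F τ C) {s : ℝ} (hs : s ∈ Ioo 0 τ) : Continuous (F s) :=
  continuous_iff_continuousAt.2 fun x =>
    ContinuousAt.comp (g := fun z : ℝ × E => F z.1 z.2) (x := x) (h.continuousAt hs x)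
      (Continuous.prodMk_right s).continuousAt

lemma nonneg (h : SqrtSingular F τ C) (hτ : 0 < τ) : 0 ≤ C := by
  have h1 := (norm_nonneg _).trans (h.bound (τ / 2) ⟨by linarith, by linarith⟩ 0)
  have h2 : 0 < (√(τ / 2))⁻¹ := by positivity
  exact nonneg_of_mul_nonneg_left h1 h2

section Param

variable {X : Type*} [TopologicalSpace X] [FirstCountableTopology X]
  {a ς : X → ℝ} {y : X → E} {q₀ : X}

lemma eventually_bound (h : SqrtSingular F τ C) (ha : ContinuousAt a q₀) (h0 : a q₀ ∈ Ioo 0 τ) :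
    ∀ᶠ q in 𝓝 q₀, ∀ z, ‖F (a q) z‖ ≤ C * (√(a q₀ / 2))⁻¹ := by
  have hC := h.nonneg (h0.1.trans h0.2)
  have h1 : Ioo (a q₀ / 2) τ ∈ 𝓝 (a q₀) := Ioo_mem_nhds (by linarith [h0.1]) h0.2
  filter_upwards [ha h1] with q hq z
  have h2 : 0 < a q₀ / 2 := by linarith [h0.1]
  refine (h.bound (a q) ⟨h2.trans hq.1, hq.2⟩ z).trans ?_
  gcongr
  exact hq.1.le

lemma continuousAt_comp (h : SqrtSingular F τ C) (ha : ContinuousAt a q₀) (h0 : a q₀ ∈ Ioo 0 τ)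
    (z : E) : ContinuousAt (fun q : X × E => F (a q.1) q.2) (q₀, z) := by
  have h1 : ContinuousAt (fun q : X × E => (a q.1, q.2)) (q₀, z) := by
    have : ContinuousAt (fun q : X × E => a q.1) (q₀, z) :=
      ContinuousAt.comp (g := a) (x := (q₀, z)) ha continuousAt_fst
    exact this.prodMk continuousAt_snd
  exact ContinuousAt.comp (g := fun z : ℝ × E => F z.1 z.2) (x := (q₀, z))
    (h.continuousAt h0 z) h1

lemma eventually_continuous (h : SqrtSingular F τ C) (ha : ContinuousAt a q₀)
    (h0 : a q₀ ∈ Ioo 0 τ) : ∀ᶠ q in 𝓝 q₀, Continuous (F (a q)) := by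
  filter_upwards [ha (isOpen_Ioo.mem_nhds h0)] with q hq using h.continuous hq

lemma continuousAt_heat (h : SqrtSingular F τ C) (ha : ContinuousAt a q₀) (h0 : a q₀ ∈ Ioo 0 τ)
    (hς : ContinuousAt ς q₀) (hy : ContinuousAt y q₀) :
    ContinuousAt (fun q => heat (ς q) (F (a q)) (y q)) q₀ :=
  _root_.continuousAt_heat (g := fun q => F (a q)) hς hy (h.continuousAt_comp ha h0)
    (h.eventually_bound ha h0) (h.eventually_continuous ha h0)

lemma continuousAt_heatGrad (h : SqrtSingular F τ C) (ha : ContinuousAt a q₀)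
    (h0 : a q₀ ∈ Ioo 0 τ) (hς : ContinuousAt ς q₀) (hy : ContinuousAt y q₀) (hne : ς q₀ ≠ 0) :
    ContinuousAt (fun q => heatGrad (ς q) (F (a q)) (y q)) q₀ :=
  _root_.continuousAt_heatGrad (g := fun q => F (a q)) hς hy hne (h.continuousAt_comp ha h0)
    (h.eventually_bound ha h0) (h.eventually_continuous ha h0)

end Param

lemma mul_mem {t θ : ℝ} (ht : t ∈ Ioo 0 τ) (hθ : θ ∈ Ioo (0 : ℝ) 1) : t * θ ∈ Ioo 0 τ :=
  ⟨mul_pos ht.1 hθ.1, (mul_lt_of_lt_one_right ht.1 hθ.2).trans ht.2⟩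

lemma sqrt_pos {t θ : ℝ} (ht : t ∈ Ioo 0 τ) (hθ : θ ∈ Ioo (0 : ℝ) 1) :
    0 < √(2 * (t * (1 - θ))) :=
  Real.sqrt_pos.2 (mul_pos two_pos (mul_pos ht.1 (by linarith [hθ.2])))

lemma aestronglyMeasurable_heat (h : SqrtSingular F τ C) {t : ℝ} (ht : t ∈ Ioo 0 τ) (x : E) :
    AEStronglyMeasurable (fun θ => heat (√(2 * (t * (1 - θ)))) (F (t * θ)) x)
      (volume.restrict (Ioo 0 1)) := by
  refine ContinuousOn.aestronglyMeasurable (fun θ hθ => ContinuousAt.continuousWithinAt ?_)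
    measurableSet_Ioo
  exact h.continuousAt_heat (a := fun θ => t * θ) (by fun_prop) (mul_mem ht hθ)
    (by fun_prop) continuousAt_const

lemma aestronglyMeasurable_heatGrad (h : SqrtSingular F τ C) {t : ℝ} (ht : t ∈ Ioo 0 τ) (x : E) :
    AEStronglyMeasurable (fun θ => heatGrad (√(2 * (t * (1 - θ)))) (F (t * θ)) x)
      (volume.restrict (Ioo 0 1)) := by
  have : SecondCountableTopologyEither ℝ (E →L[ℝ] W) := ⟨Or.inl inferInstance⟩
  refine ContinuousOn.aestronglyMeasurable (fun θ hθ => ContinuousAt.continuousWithinAt ?_)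
    measurableSet_Ioo
  exact h.continuousAt_heatGrad (a := fun θ => t * θ) (by fun_prop) (mul_mem ht hθ)
    (by fun_prop) continuousAt_const (sqrt_pos ht hθ).ne'

lemma norm_heat_le (h : SqrtSingular F τ C) {t θ : ℝ} (ht : t ∈ Ioo 0 τ)
    (hθ : θ ∈ Ioo (0 : ℝ) 1) (x : E) :
    ‖heat (√(2 * (t * (1 - θ)))) (F (t * θ)) x‖ ≤ C * (√t)⁻¹ * (√θ)⁻¹ := by
  refine (_root_.norm_heat_le (h.bound _ (mul_mem ht hθ)) _ _).trans (le_of_eq ?_)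
  rw [Real.sqrt_mul ht.1.le, mul_inv, mul_assoc]

lemma norm_heatGrad_le (h : SqrtSingular F τ C) {t θ : ℝ} (ht : t ∈ Ioo 0 τ)
    (hθ : θ ∈ Ioo (0 : ℝ) 1) (x : E) :
    ‖heatGrad (√(2 * (t * (1 - θ)))) (F (t * θ)) x‖ ≤
      (∫ z, ‖z‖ ∂(stdGaussian E)) * C * t⁻¹ * ((√(1 - θ))⁻¹ * (√θ)⁻¹) := by
  have hC := h.nonneg (ht.1.trans ht.2)
  have hm : 0 ≤ ∫ z, ‖z‖ ∂(stdGaussian E) := integral_nonneg fun z => norm_nonneg z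
  refine (_root_.norm_heatGrad_le (h.bound _ (mul_mem ht hθ)) _ _).trans ?_
  rw [abs_of_pos (sqrt_pos ht hθ), Real.sqrt_mul ht.1.le, Real.sqrt_mul zero_le_two,
    Real.sqrt_mul ht.1.le]
  have h1 : (√t)⁻¹ * (√t)⁻¹ = t⁻¹ := by rw [← mul_inv, Real.mul_self_sqrt ht.1.le]
  have h2 : (√2)⁻¹ ≤ 1 := inv_le_one_of_one_le₀ (Real.one_le_sqrt.2 one_le_two)
  rw [mul_inv, mul_inv, mul_inv]
  calc _ = (√2)⁻¹ * ((∫ z, ‖z‖ ∂(stdGaussian E)) * C * ((√t)⁻¹ * (√t)⁻¹) *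
        ((√(1 - θ))⁻¹ * (√θ)⁻¹)) := by ring
    _ ≤ 1 * ((∫ z, ‖z‖ ∂(stdGaussian E)) * C * ((√t)⁻¹ * (√t)⁻¹) *
        ((√(1 - θ))⁻¹ * (√θ)⁻¹)) := by gcongr
    _ = _ := by rw [h1, one_mul]

/-- The kernel contributes `(t(1-θ))^(-1/2)` and the source `(tθ)^(-1/2)`. Together they give `t⁻¹`,
cancelled by the outer factor `t`, so the bound is uniform in time. -/
lemma norm_duhamelGrad_le (h : SqrtSingular F τ C) {t : ℝ} (ht : t ∈ Ioo 0 τ) (x : E) :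
    ‖duhamelGrad F t x‖ ≤ (∫ z, ‖z‖ ∂(stdGaussian E)) * C *
      ∫ θ in Ioo (0 : ℝ) 1, (√(1 - θ))⁻¹ * (√θ)⁻¹ := by
  have h1 : ‖∫ θ in Ioo (0 : ℝ) 1, heatGrad (√(2 * (t * (1 - θ)))) (F (t * θ)) x‖ ≤
      ∫ θ in Ioo (0 : ℝ) 1,
        (∫ z, ‖z‖ ∂(stdGaussian E)) * C * t⁻¹ * ((√(1 - θ))⁻¹ * (√θ)⁻¹) := by
    refine norm_integral_le_of_norm_le (integrableOn_inv_sqrt_mul_inv_sqrt.const_mul _) ?_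
    filter_upwards [ae_restrict_mem measurableSet_Ioo] with θ hθ
    exact h.norm_heatGrad_le ht hθ x
  rw [integral_const_mul] at h1
  rw [duhamelGrad, norm_smul, Real.norm_of_nonneg ht.1.le]
  refine (mul_le_mul_of_nonneg_left h1 ht.1.le).trans (le_of_eq ?_)
  have := ht.1.ne'
  field_simp

/-- Rescaling to the unit interval makes the domain of integration independent of `t`, so dominated
convergence applies directly. -/
lemma continuousOn_duhamelGrad (h : SqrtSingular F τ C) :
    ContinuousOn (fun z : ℝ × E => duhamelGrad F z.1 z.2) (Ioo 0 τ ×ˢ univ) := by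
  rintro ⟨t, x⟩ ⟨ht, -⟩
  have ht : t ∈ Ioo 0 τ := ht
  have hC := h.nonneg (ht.1.trans ht.2)
  have hm : 0 ≤ ∫ z, ‖z‖ ∂(stdGaussian E) := integral_nonneg fun z => norm_nonneg z
  refine ContinuousAt.continuousWithinAt (continuousAt_fst.smul ?_)
  refine continuousAt_of_dominated (bound := fun θ => (∫ z, ‖z‖ ∂(stdGaussian E)) * C *
    (t / 2)⁻¹ * ((√(1 - θ))⁻¹ * (√θ)⁻¹)) ?_ ?_
    (integrableOn_inv_sqrt_mul_inv_sqrt.const_mul _) ?_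
  · filter_upwards [continuousAt_fst (isOpen_Ioo.mem_nhds ht)] with q hq
    exact h.aestronglyMeasurable_heatGrad hq _
  · have hn : Ioo (t / 2) τ ∈ 𝓝 t := Ioo_mem_nhds (by linarith [ht.1]) ht.2
    filter_upwards [continuousAt_fst hn] with q hq
    filter_upwards [ae_restrict_mem measurableSet_Ioo] with θ hθ
    have hpos : 0 < t / 2 := by linarith [ht.1]
    refine (h.norm_heatGrad_le ⟨hpos.trans hq.1, hq.2⟩ hθ _).trans ?_
    gcongr
    exact hq.1.le
  · filter_upwards [ae_restrict_mem measurableSet_Ioo] with θ hθ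
    exact h.continuousAt_heatGrad (a := fun q : ℝ × E => q.1 * θ) (q₀ := (t, x)) (by fun_prop)
      (mul_mem ht hθ) (by fun_prop) continuousAt_snd (sqrt_pos ht hθ).ne'

lemma integrableOn_heat (h : SqrtSingular F τ C) {t : ℝ} (ht : t ∈ Ioo 0 τ) (x : E) :
    IntegrableOn (fun θ => heat (√(2 * (t * (1 - θ)))) (F (t * θ)) x) (Ioo 0 1) := by
  refine Integrable.mono' (integrableOn_inv_sqrt.const_mul (C * (√t)⁻¹))
    (h.aestronglyMeasurable_heat ht x) ?_
  filter_upwards [ae_restrict_mem measurableSet_Ioo] with θ hθ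
  exact h.norm_heat_le ht hθ x

lemma hasFDerivAt_duhamel (h : SqrtSingular F τ C) {t : ℝ} (ht : t ∈ Ioo 0 τ) (x : E) :
    HasFDerivAt (duhamel F t) (duhamelGrad F t x) x := by
  refine HasFDerivAt.const_smul (f := fun x => ∫ θ in Ioo (0 : ℝ) 1,
    heat (√(2 * (t * (1 - θ)))) (F (t * θ)) x) ?_ t
  refine hasFDerivAt_integral_of_dominated_of_fderiv_le
    (F' := fun x θ => heatGrad (√(2 * (t * (1 - θ)))) (F (t * θ)) x)
    (bound := fun θ => (∫ z, ‖z‖ ∂(stdGaussian E)) * C * t⁻¹ * ((√(1 - θ))⁻¹ * (√θ)⁻¹))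
    univ_mem ?_ (h.integrableOn_heat ht x) (h.aestronglyMeasurable_heatGrad ht x) ?_
    (integrableOn_inv_sqrt_mul_inv_sqrt.const_mul _) ?_
  · exact Eventually.of_forall fun y => h.aestronglyMeasurable_heat ht y
  · filter_upwards [ae_restrict_mem measurableSet_Ioo] with θ hθ y _
    exact h.norm_heatGrad_le ht hθ y
  · filter_upwards [ae_restrict_mem measurableSet_Ioo] with θ hθ y _
    exact hasFDerivAt_heat (h.continuous (mul_mem ht hθ)) (h.bound _ (mul_mem ht hθ))
      (sqrt_pos ht hθ).ne' y

/-- Two derivatives on the kernel would cost the non-integrable `1/(t - s)`. Putting one on the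
source leaves only one for the kernel. -/
lemma hasFDerivAt_duhamel_of_hasFDerivAt (h : SqrtSingular F τ C) {F' : ℝ → E → E →L[ℝ] W}
    {C' : ℝ} (h' : SqrtSingular F' τ C') (hd : ∀ s ∈ Ioo 0 τ, ∀ x, HasFDerivAt (F s) (F' s x) x)
    {t : ℝ} (ht : t ∈ Ioo 0 τ) (x : E) :
    HasFDerivAt (duhamel F t) (duhamel F' t x) x := by
  refine HasFDerivAt.const_smul (f := fun x => ∫ θ in Ioo (0 : ℝ) 1,
    heat (√(2 * (t * (1 - θ)))) (F (t * θ)) x) ?_ t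
  refine hasFDerivAt_integral_of_dominated_of_fderiv_le
    (F' := fun x θ => heat (√(2 * (t * (1 - θ)))) (F' (t * θ)) x)
    (bound := fun θ => C' * (√t)⁻¹ * (√θ)⁻¹)
    univ_mem ?_ (h.integrableOn_heat ht x) (h'.aestronglyMeasurable_heat ht x) ?_
    (integrableOn_inv_sqrt.const_mul _) ?_
  · exact Eventually.of_forall fun y => h.aestronglyMeasurable_heat ht y
  · filter_upwards [ae_restrict_mem measurableSet_Ioo] with θ hθ y _
    exact h'.norm_heat_le ht hθ y
  · filter_upwards [ae_restrict_mem measurableSet_Ioo] with θ hθ y _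
    exact hasFDerivAt_heat_of_hasFDerivAt (hd _ (mul_mem ht hθ)) (h'.continuous (mul_mem ht hθ))
      (h.bound _ (mul_mem ht hθ)) (h'.bound _ (mul_mem ht hθ)) _ y

end SqrtSingular

end Duhamel

/-! ### The nonlinearity and its local Lipschitz bound. -/

section SignedPow

/-- The nonlinearity `|y|^(p-1) y`. -/
noncomputable def signedPow (p y : ℝ) : ℝ := |y| ^ (p - 1) * y

variable {p : ℝ}

lemma signedPow_of_nonneg (hp : 1 < p) {y : ℝ} (hy : 0 ≤ y) : signedPow p y = y ^ p := by
  rcases hy.eq_or_lt with rfl | h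
  · simp [signedPow, Real.zero_rpow (by linarith : p ≠ 0)]
  · rw [signedPow, abs_of_pos h, Real.rpow_sub_one h.ne', div_mul_cancel₀ _ h.ne']

lemma signedPow_neg (p y : ℝ) : signedPow p (-y) = -signedPow p y := by
  simp [signedPow]

lemma continuous_signedPow (hp : 1 < p) : Continuous (signedPow p) :=
  (continuous_abs.rpow_const fun _ => Or.inr (by linarith)).mul continuous_id

lemma hasDerivAt_signedPow (hp : 1 < p) (y : ℝ) :
    HasDerivAt (signedPow p) (p * |y| ^ (p - 1)) y := by
  have hpos : ∀ y : ℝ, 0 < y → HasDerivAt (signedPow p) (p * |y| ^ (p - 1)) y := by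
    intro y hy
    rw [abs_of_pos hy]
    refine (Real.hasDerivAt_rpow_const (Or.inl hy.ne')).congr_of_eventuallyEq ?_
    filter_upwards [lt_mem_nhds hy] with z hz using signedPow_of_nonneg hp hz.le
  rcases lt_trichotomy y 0 with hy | rfl | hy
  · have h1 := (hpos (-y) (by linarith)).comp y (hasDerivAt_neg y)
    have h2 : signedPow p ∘ Neg.neg = fun x => -signedPow p x :=
      funext fun x => signedPow_neg p x
    rw [h2] at h1
    have h3 := h1.neg
    rw [show -(fun x => -signedPow p x) = signedPow p from neg_neg (signedPow p)] at h3
    simpa using h3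
  · rw [abs_zero, Real.zero_rpow (by linarith), mul_zero, hasDerivAt_iff_tendsto_slope]
    have h1 : Tendsto (fun y : ℝ => |y| ^ (p - 1)) (𝓝[≠] 0) (𝓝 0) := by
      have : Continuous (fun y : ℝ => |y| ^ (p - 1)) :=
        continuous_abs.rpow_const fun _ => Or.inr (by linarith)
      have h2 := this.tendsto 0
      rw [abs_zero, Real.zero_rpow (by linarith)] at h2
      exact h2.mono_left nhdsWithin_le_nhds
    refine h1.congr' ?_
    filter_upwards [self_mem_nhdsWithin] with z hz
    have hz : z ≠ 0 := hz
    rw [slope_def_field]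
    simp [signedPow, hz]
  · exact hpos y hy

lemma abs_signedPow_le (hp : 1 < p) {y R : ℝ} (hy : |y| ≤ R) : |signedPow p y| ≤ R ^ p := by
  have h1 : |signedPow p y| = signedPow p |y| := by
    simp [signedPow, abs_mul, abs_of_nonneg (Real.rpow_nonneg (abs_nonneg y) _)]
  rw [h1, signedPow_of_nonneg hp (abs_nonneg y)]
  exact Real.rpow_le_rpow (abs_nonneg _) hy (by linarith)

lemma abs_deriv_signedPow_le (hp : 1 < p) {y R : ℝ} (hy : |y| ≤ R) :
    |p * |y| ^ (p - 1)| ≤ p * R ^ (p - 1) := by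
  rw [abs_of_nonneg (mul_nonneg (by linarith) (Real.rpow_nonneg (abs_nonneg _) _))]
  exact mul_le_mul_of_nonneg_left (Real.rpow_le_rpow (abs_nonneg _) hy (by linarith)) (by linarith)

lemma abs_signedPow_sub_le (hp : 1 < p) {a b R : ℝ} (ha : |a| ≤ R) (hb : |b| ≤ R) :
    |signedPow p a - signedPow p b| ≤ p * R ^ (p - 1) * |a - b| :=
  (convex_Icc (-R) R).norm_image_sub_le_of_norm_hasDerivWithin_le
    (fun y _ => (hasDerivAt_signedPow hp y).hasDerivWithinAt)
    (fun _ hy => abs_deriv_signedPow_le hp (abs_le.2 hy)) (abs_le.1 hb) (abs_le.1 ha)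

end SignedPow

/-! ### First and second space derivatives of the mild formula. -/

section MildRegularity

set_option linter.unusedSectionVars false

variable {E : Type*} [NormedAddCommGroup E] [InnerProductSpace ℝ E] [FiniteDimensional ℝ E]
  [MeasurableSpace E] [BorelSpace E]
  {W : Type*} [NormedAddCommGroup W] [NormedSpace ℝ W]
  {φ : E → W} {M τ C C' : ℝ} {F : ℝ → E → W} {F' : ℝ → E → E →L[ℝ] W}

lemma sqrt_two_mul_pos {t : ℝ} (ht : t ∈ Ioo 0 τ) : 0 < √(2 * t) :=
  Real.sqrt_pos.2 (mul_pos two_pos ht.1)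

lemma SqrtSingular.of_bounded
    (hc : ContinuousOn (fun z : ℝ × E => F z.1 z.2) (Ioo 0 τ ×ˢ univ))
    (hb : ∀ s ∈ Ioo 0 τ, ∀ x, ‖F s x‖ ≤ C) : SqrtSingular F τ (C * √τ) := by
  refine ⟨hc, fun s hs x => (hb s hs x).trans ?_⟩
  have hC := (norm_nonneg _).trans (hb s hs x)
  rw [mul_assoc]
  refine le_mul_of_one_le_right hC ?_
  rw [← div_eq_mul_inv, one_le_div (Real.sqrt_pos.2 hs.1)]
  exact Real.sqrt_le_sqrt hs.2.le

lemma hasFDerivAt_mild (hφ : Continuous φ) (hM : ∀ x, ‖φ x‖ ≤ M) (hF : SqrtSingular F τ C)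
    {t : ℝ} (ht : t ∈ Ioo 0 τ) (x : E) :
    HasFDerivAt (fun x => heat (√(2 * t)) φ x + duhamel F t x)
      (heatGrad (√(2 * t)) φ x + duhamelGrad F t x) x :=
  (hasFDerivAt_heat hφ hM (sqrt_two_mul_pos ht).ne' x).add (hF.hasFDerivAt_duhamel ht x)

/-- The class `SqrtSingular` is stable under one step of the bootstrap: the gradient of the free
evolution is `O(t^(-1/2))`, and that of the Duhamel term is bounded. -/
lemma sqrtSingular_mildGrad (hφ : Continuous φ) (hM : ∀ x, ‖φ x‖ ≤ M)
    (hF : SqrtSingular F τ C) :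
    ∃ K, SqrtSingular (fun t x => heatGrad (√(2 * t)) φ x + duhamelGrad F t x) τ K := by
  have hm : 0 ≤ ∫ z, ‖z‖ ∂(stdGaussian E) := integral_nonneg fun z => norm_nonneg z
  have hM0 : 0 ≤ M := (norm_nonneg _).trans (hM 0)
  set m := ∫ z, ‖z‖ ∂(stdGaussian E)
  set B := m * C * ∫ θ in Ioo (0 : ℝ) 1, (√(1 - θ))⁻¹ * (√θ)⁻¹
  refine ⟨m * M + B * √τ, ?_, ?_⟩
  · refine ContinuousOn.add (fun q hq => ContinuousAt.continuousWithinAt ?_)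
      hF.continuousOn_duhamelGrad
    refine continuousAt_heatGrad (g := fun _ => φ) (by fun_prop) continuousAt_snd
      (sqrt_two_mul_pos hq.1).ne' (fun _ => by fun_prop) (Eventually.of_forall fun _ => hM)
      (Eventually.of_forall fun _ => hφ)
  · intro t ht x
    have hst : 0 < √t := Real.sqrt_pos.2 ht.1
    refine (norm_add_le _ _).trans ?_
    rw [add_mul]
    refine add_le_add ?_ ?_
    · refine (norm_heatGrad_le hM _ _).trans ?_
      rw [abs_of_pos (sqrt_two_mul_pos ht), mul_comm]
      gcongr
      linarith [ht.1]
    · have h1 := hF.norm_duhamelGrad_le ht x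
      have hB : 0 ≤ B := (norm_nonneg _).trans h1
      refine h1.trans ?_
      rw [mul_assoc B]
      refine le_mul_of_one_le_right hB ?_
      rw [← div_eq_mul_inv, one_le_div hst]
      exact Real.sqrt_le_sqrt ht.2.le

/-- This is `∇S(t) = S(t/2)∇S(t/2)`; the outer half of the time is kept to absorb a second
derivative. -/
lemma heatGrad_sqrt_two_mul (hφ : Continuous φ) (hM : ∀ x, ‖φ x‖ ≤ M) {t : ℝ} (ht : 0 < t) :
    heatGrad (√(2 * t)) φ = heat (√t) (heatGrad (√t) φ) := by
  funext x
  have hs : √t ≠ 0 := (Real.sqrt_pos.2 ht).ne'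
  have h1 : heat (√(2 * t)) φ = heat (√t) (heat (√t) φ) := by
    funext y
    rw [heat_heat hφ hM (ρ := √(2 * t))]
    rw [Real.sq_sqrt (by positivity), Real.sq_sqrt ht.le]
    ring
  have h2 := hasFDerivAt_heat hφ hM (Real.sqrt_pos.2 (by positivity : 0 < 2 * t)).ne' x
  rw [h1] at h2
  exact h2.unique (hasFDerivAt_heat_of_hasFDerivAt (hasFDerivAt_heat hφ hM hs)
    (continuous_heatGrad hφ hM hs) (norm_heat_le hM _) (norm_heatGrad_le hM _) _ _)

lemma hasFDerivAt_mildGrad (hφ : Continuous φ) (hM : ∀ x, ‖φ x‖ ≤ M) (hF : SqrtSingular F τ C)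
    (hF' : SqrtSingular F' τ C') (hd : ∀ s ∈ Ioo 0 τ, ∀ x, HasFDerivAt (F s) (F' s x) x)
    {t : ℝ} (ht : t ∈ Ioo 0 τ) (x : E) :
    HasFDerivAt (fun x => heatGrad (√(2 * t)) φ x + duhamelGrad F t x)
      (heatGrad (√t) (heatGrad (√t) φ) x + duhamelGrad F' t x) x := by
  have hs : √t ≠ 0 := (Real.sqrt_pos.2 ht.1).ne'
  have h1 : duhamelGrad F t = duhamel F' t := funext fun y =>
    (hF.hasFDerivAt_duhamel ht y).unique (hF.hasFDerivAt_duhamel_of_hasFDerivAt hF' hd ht y)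
  rw [heatGrad_sqrt_two_mul hφ hM ht.1, h1]
  exact (hasFDerivAt_heat (continuous_heatGrad hφ hM hs) (norm_heatGrad_le hM _) hs x).add
    (hF'.hasFDerivAt_duhamel ht x)

lemma continuousOn_mildHess (hφ : Continuous φ) (hM : ∀ x, ‖φ x‖ ≤ M)
    (hF' : SqrtSingular F' τ C') :
    ContinuousOn (fun z : ℝ × E => heatGrad (√z.1) (heatGrad (√z.1) φ) z.2 +
      duhamelGrad F' z.1 z.2) (Ioo 0 τ ×ˢ univ) := by
  refine ContinuousOn.add (fun q hq => ContinuousAt.continuousWithinAt ?_)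
    hF'.continuousOn_duhamelGrad
  have hm : 0 ≤ ∫ z, ‖z‖ ∂(stdGaussian E) := integral_nonneg fun z => norm_nonneg z
  have hM0 : 0 ≤ M := (norm_nonneg _).trans (hM 0)
  have hq : q.1 ∈ Ioo 0 τ := hq.1
  have hpos : 0 < q.1 / 2 := by linarith [hq.1]
  have hnhds : ∀ᶠ r : ℝ × E in 𝓝 q, q.1 / 2 < r.1 :=
    continuousAt_fst (Ioi_mem_nhds (by linarith [hq.1]))
  refine continuousAt_heatGrad (g := fun r : ℝ × E => heatGrad (√r.1) φ)
    (C := (√(q.1 / 2))⁻¹ * ((∫ z, ‖z‖ ∂(stdGaussian E)) * M)) (by fun_prop) continuousAt_snd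
    (Real.sqrt_pos.2 hq.1).ne' (fun z => ?_) ?_ ?_
  · exact continuousAt_heatGrad (g := fun _ => φ) (ς := fun r : (ℝ × E) × E => √r.1.1)
      (q₀ := (q, z)) (by fun_prop) continuousAt_snd
      (Real.sqrt_pos.2 hq.1).ne' (fun _ => by fun_prop) (Eventually.of_forall fun _ => hM)
      (Eventually.of_forall fun _ => hφ)
  · filter_upwards [hnhds] with r hr z
    refine (norm_heatGrad_le hM _ _).trans ?_
    rw [abs_of_nonneg (Real.sqrt_nonneg _)]
    gcongr
  · filter_upwards [hnhds] with r hr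
    exact continuous_heatGrad hφ hM (Real.sqrt_pos.2 (hpos.trans hr)).ne'

lemma exists_norm_mildHess_le (hM : ∀ x, ‖φ x‖ ≤ M) (hF' : SqrtSingular F' τ C')
    {t : ℝ} (ht : t ∈ Ioo 0 τ) :
    ∃ K, ∀ x, ‖heatGrad (√t) (heatGrad (√t) φ) x + duhamelGrad F' t x‖ ≤ K :=
  ⟨_, fun x => (norm_add_le _ _).trans (add_le_add
    (norm_heatGrad_le (norm_heatGrad_le hM _) _ x) (hF'.norm_duhamelGrad_le ht x))⟩

end MildRegularity

/-! ### Duhamel integrals of bounded continuous sources. -/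

section BoundedDuhamel

set_option linter.unusedSectionVars false

variable {E : Type*} [NormedAddCommGroup E] [InnerProductSpace ℝ E] [FiniteDimensional ℝ E]
  [MeasurableSpace E] [BorelSpace E]
  {φ : E → ℝ} {F G : ℝ → E → ℝ} {M K : ℝ}

lemma continuous_heat_duhamel (hF : Continuous fun z : ℝ × E => F z.1 z.2)
    (hK : ∀ s x, |F s x| ≤ K) :
    Continuous fun q : (ℝ × E) × ℝ =>
      heat (√(2 * (q.1.1 * (1 - q.2)))) (F (q.1.1 * q.2)) q.1.2 :=
  continuous_heat_param (g := fun q : (ℝ × E) × ℝ => F (q.1.1 * q.2)) (by fun_prop) (by fun_prop)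
    (hF.comp (f := fun r : ((ℝ × E) × ℝ) × E => (r.1.1.1 * r.1.2, r.2)) (by fun_prop))
    fun _ => hK _

lemma continuous_duhamel (hF : Continuous fun z : ℝ × E => F z.1 z.2)
    (hK : ∀ s x, |F s x| ≤ K) : Continuous fun z : ℝ × E => duhamel F z.1 z.2 := by
  have hc := continuous_heat_duhamel hF hK
  refine continuous_fst.smul (continuous_of_dominated (bound := fun _ => K) ?_ ?_ ?_ ?_)
  · intro q
    exact (hc.comp (Continuous.prodMk_right q)).aestronglyMeasurable
  · exact fun q => ae_of_all _ fun θ => norm_heat_le (hK _) _ _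
  · exact integrable_const _
  · exact ae_of_all _ fun θ => hc.comp (Continuous.prodMk_left θ)

lemma integrableOn_heat_duhamel (hF : Continuous fun z : ℝ × E => F z.1 z.2)
    (hK : ∀ s x, |F s x| ≤ K) (t : ℝ) (x : E) :
    IntegrableOn (fun θ => heat (√(2 * (t * (1 - θ)))) (F (t * θ)) x) (Ioo 0 1) :=
  Integrable.of_bound ((continuous_heat_duhamel hF hK).comp
    (Continuous.prodMk_right (t, x))).aestronglyMeasurable K
    (ae_of_all _ fun _ => norm_heat_le (hK _) _ _)

lemma abs_duhamel_le (hK : ∀ s x, |F s x| ≤ K) (t : ℝ) (x : E) : |duhamel F t x| ≤ |t| * K := by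
  rw [duhamel, smul_eq_mul, abs_mul]
  gcongr
  have := norm_setIntegral_le_of_norm_le_const (μ := volume) (s := Ioo (0 : ℝ) 1)
    (f := fun θ => heat (√(2 * (t * (1 - θ)))) (F (t * θ)) x) (C := K) (by simp)
    (fun θ _ => norm_heat_le (hK _) _ _)
  simpa using this

lemma heat_sub (hcφ : Continuous φ) (hφ : ∀ x, ‖φ x‖ ≤ M) {ψ : E → ℝ} {M' : ℝ}
    (hcψ : Continuous ψ) (hψ : ∀ x, ‖ψ x‖ ≤ M') (σ : ℝ) (x : E) :
    heat σ (fun y => φ y - ψ y) x = heat σ φ x - heat σ ψ x :=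
  integral_sub (integrable_heat hcφ hφ σ x) (integrable_heat hcψ hψ σ x)

lemma heat_add (hcφ : Continuous φ) (hφ : ∀ x, ‖φ x‖ ≤ M) {ψ : E → ℝ} {M' : ℝ}
    (hcψ : Continuous ψ) (hψ : ∀ x, ‖ψ x‖ ≤ M') (σ : ℝ) (x : E) :
    heat σ (fun y => φ y + ψ y) x = heat σ φ x + heat σ ψ x :=
  integral_add (integrable_heat hcφ hφ σ x) (integrable_heat hcψ hψ σ x)

lemma duhamel_sub (hF : Continuous fun z : ℝ × E => F z.1 z.2) (hK : ∀ s x, |F s x| ≤ K)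
    {K' : ℝ} (hG : Continuous fun z : ℝ × E => G z.1 z.2) (hK' : ∀ s x, |G s x| ≤ K')
    (t : ℝ) (x : E) :
    duhamel (fun s y => F s y - G s y) t x = duhamel F t x - duhamel G t x := by
  have h1 : ∀ s, Continuous (F s) := fun s => hF.comp (Continuous.prodMk_right s)
  have h2 : ∀ s, Continuous (G s) := fun s => hG.comp (Continuous.prodMk_right s)
  rw [duhamel, duhamel, duhamel, ← smul_sub, ← integral_sub (integrableOn_heat_duhamel hF hK t x)
    (integrableOn_heat_duhamel hG hK' t x)]
  congr 2
  funext θ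
  exact heat_sub (h1 _) (hK _) (h2 _) (hK' _) _ _

lemma duhamel_eq_intervalIntegral (F : ℝ → E → ℝ) (t : ℝ) (x : E) :
    duhamel F t x = ∫ s in (0 : ℝ)..t, heat (√(2 * (t - s))) (F s) x := by
  rw [duhamel, ← integral_Ioc_eq_integral_Ioo, ← intervalIntegral.integral_of_le zero_le_one]
  have := intervalIntegral.smul_integral_comp_mul_left (a := 0) (b := 1)
    (fun s => heat (√(2 * (t - s))) (F s) x) t
  rw [mul_zero, mul_one] at this
  rw [← this]
  congr 2
  funext θ
  rw [mul_sub, mul_one]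

lemma heat_duhamel (hF : Continuous fun z : ℝ × E => F z.1 z.2) (hK : ∀ s x, |F s x| ≤ K)
    (σ t : ℝ) (x : E) :
    heat σ (duhamel F t) x =
      t • ∫ θ in Ioo (0 : ℝ) 1, heat σ (heat (√(2 * (t * (1 - θ)))) (F (t * θ))) x := by
  simp only [duhamel, heat, integral_smul]
  congr 1
  refine integral_integral_swap (f := fun (z : E) (θ : ℝ) =>
    heat (√(2 * (t * (1 - θ)))) (F (t * θ)) (x + σ • z)) ?_
  have hc : Continuous fun q : E × ℝ =>
      heat (√(2 * (t * (1 - q.2)))) (F (t * q.2)) (x + σ • q.1) :=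
    (continuous_heat_duhamel hF hK).comp
      (f := fun q : E × ℝ => ((t, x + σ • q.1), q.2)) (by fun_prop)
  exact Integrable.of_bound hc.aestronglyMeasurable K
    (ae_of_all _ fun _ => norm_heat_le (hK _) _ _)

/-- The time integral is split at `t`, and the semigroup law factors `S(h)` out of the earlier part.
-/
lemma duhamel_add (hF : Continuous fun z : ℝ × E => F z.1 z.2) (hK : ∀ s x, |F s x| ≤ K)
    {t h : ℝ} (ht : 0 ≤ t) (hh : 0 ≤ h) (x : E) :
    duhamel F (t + h) x =
      heat (√(2 * h)) (duhamel F t) x + duhamel (fun s => F (t + s)) h x := by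
  have hc : ∀ r : ℝ, Continuous fun s => heat (√(2 * (r - s))) (F s) x := fun r =>
    continuous_heat_param (g := F) (by fun_prop) continuous_const hF hK
  rw [duhamel_eq_intervalIntegral F, ← intervalIntegral.integral_add_adjacent_intervals
    ((hc _).intervalIntegrable 0 t) ((hc _).intervalIntegrable t (t + h))]
  congr 1
  · rw [heat_duhamel hF hK, ← integral_Ioc_eq_integral_Ioo,
      ← intervalIntegral.integral_of_le zero_le_one]
    have := intervalIntegral.smul_integral_comp_mul_left (a := 0) (b := 1)
      (fun s => heat (√(2 * (t + h - s))) (F s) x) t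
    rw [mul_zero, mul_one] at this
    rw [← this]
    congr 1
    refine intervalIntegral.integral_congr fun θ hθ => ?_
    rw [uIcc_of_le zero_le_one] at hθ
    have h1 : 0 ≤ t * (1 - θ) := mul_nonneg ht (by linarith [hθ.2])
    have hFc : Continuous (F (t * θ)) := hF.comp (Continuous.prodMk_right _)
    rw [heat_heat (ρ := √(2 * (t + h - t * θ))) hFc (hK _)]
    rw [Real.sq_sqrt (by nlinarith), Real.sq_sqrt (by positivity), Real.sq_sqrt (by positivity)]
    ring
  · have := intervalIntegral.integral_comp_add_left (a := 0) (b := h)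
      (fun s => heat (√(2 * (t + h - s))) (F s) x) t
    rw [add_zero] at this
    rw [duhamel_eq_intervalIntegral, ← this]
    congr 1
    funext s
    rw [add_sub_add_left_eq_sub]

end BoundedDuhamel

/-! ### From one-sided to two-sided time derivatives. -/

section RightDerivative

/-- A continuous function with a continuous right derivative is differentiable. -/
lemma hasDerivAt_of_continuousOn_right_deriv {w R : ℝ → ℝ} {a b : ℝ}
    (hw : ContinuousOn w (Ioo a b)) (hR : ContinuousOn R (Ioo a b))
    (hd : ∀ t ∈ Ioo a b, HasDerivWithinAt w (R t) (Ioi t) t) {t : ℝ} (ht : t ∈ Ioo a b) :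
    HasDerivAt w (R t) t := by
  obtain ⟨c, hac, hct⟩ := exists_between ht.1
  obtain ⟨d, htd, hdb⟩ := exists_between ht.2
  have hsub : Icc c d ⊆ Ioo a b := fun s hs => ⟨hac.trans_le hs.1, hs.2.trans_lt hdb⟩
  -- The fundamental theorem needs only right derivatives; continuity of `R` then makes the integral
  -- differentiable from both sides.
  have hint : ∀ s ∈ Icc c d, ∫ r in c..s, R r = w s - w c := by
    intro s hs
    have hs' : Icc c s ⊆ Ioo a b := (Icc_subset_Icc_right hs.2).trans hsub
    refine intervalIntegral.integral_eq_sub_of_hasDeriv_right ?_ ?_ ?_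
    · rw [uIcc_of_le hs.1]; exact hw.mono hs'
    · rw [min_eq_left hs.1, max_eq_right hs.1]
      exact fun r hr => hd r (hs' (Ioo_subset_Icc_self hr))
    · refine ContinuousOn.intervalIntegrable ?_
      rw [uIcc_of_le hs.1]; exact hR.mono hs'
  have hcd : Ioo c d ∈ 𝓝 t := Ioo_mem_nhds hct htd
  have h1 : HasDerivAt (fun s => ∫ r in c..s, R r) (R t) t := by
    refine intervalIntegral.integral_hasDerivAt_right ?_ ?_ ?_
    · refine ContinuousOn.intervalIntegrable ?_
      rw [uIcc_of_le hct.le]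
      exact hR.mono ((Icc_subset_Icc_right htd.le).trans hsub)
    · exact (hR.stronglyMeasurableAtFilter isOpen_Ioo) t ht
    · exact hR.continuousAt (isOpen_Ioo.mem_nhds ht)
  have h2 := h1.const_add (w c)
  refine h2.congr_of_eventuallyEq ?_
  filter_upwards [hcd] with s hs
  simp only [hint s (Ioo_subset_Icc_self hs)]
  ring

end RightDerivative

/-! ### Mild solutions: local existence, restart, right derivatives at time zero. -/

section Mild

set_option linter.unusedSectionVars false

variable {E : Type*} [NormedAddCommGroup E] [InnerProductSpace ℝ E] [FiniteDimensional ℝ E]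
  [MeasurableSpace E] [BorelSpace E] {p : ℝ}

/-- `u` solves the integral equation with initial value `φ` on `[0, δ]`; outside this interval
it is only required to be continuous and bounded. -/
structure IsMildSolution (p : ℝ) (φ : E → ℝ) (δ : ℝ) (u : ℝ → E → ℝ) : Prop where
  continuous : Continuous fun z : ℝ × E => u z.1 z.2
  bounded : ∃ K, ∀ t x, |u t x| ≤ K
  eq : ∀ t ∈ Icc 0 δ, ∀ x,
    u t x = heat (√(2 * t)) φ x + duhamel (fun s y => signedPow p (u s y)) t x

/-- Banach's fixed point theorem for the integral equation. That `δ` is chosen before `φ` and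
depends on `M` alone is what later forces blow-up at the end of the life span. -/
theorem exists_isMildSolution (hp : 1 < p) {M : ℝ} (hM : 0 < M) :
    ∃ δ > 0, ∀ φ : E → ℝ, Continuous φ → (∀ x, |φ x| ≤ M) → ∃ u, IsMildSolution p φ δ u := by
  set R : ℝ := 2 * M with hR
  have hR0 : 0 < R := by positivity
  set K : ℝ := R ^ p with hK
  have hK0 : 0 < K := Real.rpow_pos_of_pos hR0 _
  set L : ℝ := p * R ^ (p - 1) with hL
  have hL0 : 0 < L := mul_pos (by linarith) (Real.rpow_pos_of_pos hR0 _)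
  -- The first bound keeps the Duhamel term below `M`, hence the iterates below `R = 2M`; the second
  -- makes the Lipschitz constant at most `1/2`.
  set δ : ℝ := min (M / K) (1 / (2 * L)) with hδ
  have hδ0 : 0 < δ := by positivity
  refine ⟨δ, hδ0, fun φ hφ hφM => ?_⟩
  -- Truncating values makes the source globally bounded and Lipschitz, so the contraction acts on
  -- all bounded continuous functions. The fixed point is bounded by `R`, where the truncation is
  -- invisible.
  let cl : ℝ → ℝ := fun y => max (-R) (min R y)
  have hclc : Continuous cl := by fun_prop
  have hclR : ∀ y, |cl y| ≤ R := fun y =>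
    abs_le.2 ⟨le_max_left _ _, max_le (by linarith) (min_le_left _ _)⟩
  have hcl1 : ∀ y z, |cl y - cl z| ≤ |y - z| := fun y z => by
    refine (abs_max_sub_max_le_max _ _ _ _).trans ?_
    simp only [sub_self, abs_zero]
    refine max_le (abs_nonneg _) ((abs_min_sub_min_le_max _ _ _ _).trans ?_)
    simp
  have hcl2 : ∀ y, |y| ≤ R → cl y = y := fun y hy => by
    have := abs_le.1 hy
    simp only [cl]
    rw [min_eq_right this.2, max_eq_right this.1]
  let N : ((ℝ × E) → ℝ) → ℝ → E → ℝ := fun u s y => signedPow p (cl (u (s, y)))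
  have hNc : ∀ u : (ℝ × E) → ℝ, Continuous u → Continuous fun z : ℝ × E => N u z.1 z.2 :=
    fun u hu => (continuous_signedPow hp).comp (hclc.comp hu)
  have hNK : ∀ (u : (ℝ × E) → ℝ) s y, |N u s y| ≤ K := fun u s y =>
    abs_signedPow_le hp (hclR _)
  -- Clamping time to `[0, δ]` lets the iteration run on functions defined for all real times.
  let c : ℝ → ℝ := fun t => max 0 (min t δ)
  have hcc : Continuous c := by fun_prop
  have hc0 : ∀ t, 0 ≤ c t := fun t => le_max_left _ _
  have hcδ : ∀ t, c t ≤ δ := fun t => max_le hδ0.le (min_le_right _ _)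
  have hceq : ∀ t ∈ Icc 0 δ, c t = t := fun t ht => by
    simp only [c]
    rw [min_eq_left ht.2, max_eq_right ht.1]
  let P : ((ℝ × E) → ℝ) → (ℝ × E) → ℝ := fun u z =>
    heat (√(2 * c z.1)) φ z.2 + duhamel (N u) (c z.1) z.2
  have hPc : ∀ u, Continuous u → Continuous (P u) := fun u hu => by
    refine Continuous.add ?_ ?_
    · exact continuous_heat_param (g := fun _ : ℝ × E => φ) (by fun_prop) continuous_snd
        (by fun_prop) fun _ => hφM
    · exact (continuous_duhamel (hNc u hu) (hNK u)).comp
        (f := fun z : ℝ × E => (c z.1, z.2)) (by fun_prop)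
  have hPR : ∀ u z, |P u z| ≤ R := fun u z => by
    have h1 := norm_heat_le (g := φ) (C := M) hφM (√(2 * c z.1)) z.2
    rw [Real.norm_eq_abs] at h1
    have h2 : |duhamel (N u) (c z.1) z.2| ≤ M := by
      refine (abs_duhamel_le (hNK u) _ _).trans ?_
      rw [abs_of_nonneg (hc0 _)]
      calc c z.1 * K ≤ (M / K) * K := by
            gcongr
            exact (hcδ _).trans (min_le_left _ _)
        _ = M := div_mul_cancel₀ _ hK0.ne'
    exact (abs_add_le _ _).trans (by linarith)
  let Φ : BoundedContinuousFunction (ℝ × E) ℝ → BoundedContinuousFunction (ℝ × E) ℝ := fun u =>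
    BoundedContinuousFunction.ofNormedAddCommGroup (P u) (hPc u u.continuous) R (hPR u)
  have hΦ : ContractingWith (1 / 2) Φ := by
    refine ⟨by norm_num, LipschitzWith.of_dist_le_mul fun u v => ?_⟩
    rw [BoundedContinuousFunction.dist_le (by positivity)]
    intro z
    have h1 : dist (Φ u z) (Φ v z) =
        |duhamel (fun s y => N u s y - N v s y) (c z.1) z.2| := by
      rw [duhamel_sub (hNc u u.continuous) (hNK u) (hNc v v.continuous) (hNK v), Real.dist_eq]
      simp only [Φ, P, BoundedContinuousFunction.coe_ofNormedAddCommGroup]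
      congr 1
      ring
    have h2 : ∀ s y, |N u s y - N v s y| ≤ L * dist u v := fun s y => by
      refine (abs_signedPow_sub_le hp (hclR _) (hclR _)).trans ?_
      refine mul_le_mul_of_nonneg_left ((hcl1 _ _).trans ?_) hL0.le
      rw [← Real.dist_eq]
      exact BoundedContinuousFunction.dist_coe_le_dist _
    rw [h1]
    refine (abs_duhamel_le h2 _ _).trans ?_
    rw [abs_of_nonneg (hc0 _), ← mul_assoc]
    refine mul_le_mul_of_nonneg_right ?_ dist_nonneg
    calc c z.1 * L ≤ 1 / (2 * L) * L := by
          gcongr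
          exact (hcδ _).trans (min_le_right _ _)
      _ = ((1 / 2 : NNReal) : ℝ) := by push_cast; field_simp
  have hfix := hΦ.fixedPoint_isFixedPt
  set u := hΦ.fixedPoint
  have hu : ∀ z, u z = P u z := fun z => by
    conv_lhs => rw [← hfix]
    rfl
  have huR : ∀ z, |u z| ≤ R := fun z => by rw [hu]; exact hPR _ _
  refine ⟨fun t x => u (t, x), u.continuous, ⟨R, fun t x => huR _⟩, fun t ht x => ?_⟩
  rw [hu]
  simp only [P, hceq t ht]
  have : N u = fun s y => signedPow p (u (s, y)) := by
    funext s y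
    simp only [N, hcl2 _ (huR _)]
  rw [this]

namespace IsMildSolution

variable {φ : E → ℝ} {δ : ℝ} {u : ℝ → E → ℝ}

lemma continuous_apply (hu : IsMildSolution p φ δ u) (t : ℝ) : Continuous (u t) :=
  hu.continuous.comp (Continuous.prodMk_right t)

lemma continuous_source (hp : 1 < p) (hu : IsMildSolution p φ δ u) :
    Continuous fun z : ℝ × E => signedPow p (u z.1 z.2) :=
  (continuous_signedPow hp).comp hu.continuous

lemma bounded_source (hp : 1 < p) (hu : IsMildSolution p φ δ u) :
    ∃ K, ∀ s y, |signedPow p (u s y)| ≤ K := by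
  obtain ⟨K, hK⟩ := hu.bounded
  exact ⟨K ^ p, fun s y => abs_signedPow_le hp (hK s y)⟩

lemma initial (hu : IsMildSolution p φ δ u) (hδ : 0 ≤ δ) (x : E) : u 0 x = φ x := by
  rw [hu.eq 0 ⟨le_rfl, hδ⟩]
  simp [heat_zero, duhamel]

lemma shift (hp : 1 < p) (hu : IsMildSolution p φ δ u) (hφ : Continuous φ) {M : ℝ}
    (hM : ∀ x, |φ x| ≤ M) {t : ℝ} (ht : 0 ≤ t) (htδ : t ≤ δ) :
    IsMildSolution p (u t) (δ - t) (fun s => u (t + s)) := by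
  obtain ⟨K, hK⟩ := hu.bounded
  obtain ⟨K', hK'⟩ := hu.bounded_source hp
  refine ⟨hu.continuous.comp (f := fun z : ℝ × E => (t + z.1, z.2)) (by fun_prop),
    ⟨K, fun s x => hK _ _⟩, fun h hh x => ?_⟩
  have hd := continuous_duhamel (hu.continuous_source hp) hK'
  have h1 : u t = fun y => heat (√(2 * t)) φ y +
      duhamel (fun s y => signedPow p (u s y)) t y := funext fun y => hu.eq t ⟨ht, htδ⟩ y
  have h2 : Continuous (duhamel (fun s y => signedPow p (u s y)) t) :=
    hd.comp (Continuous.prodMk_right t)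
  have h3 : heat (√(2 * (t + h))) φ x = heat (√(2 * h)) (heat (√(2 * t)) φ) x := by
    rw [heat_heat (ρ := √(2 * (t + h))) hφ hM]
    have := hh.1
    rw [Real.sq_sqrt (by positivity), Real.sq_sqrt (by positivity), Real.sq_sqrt (by positivity)]
    ring
  rw [hu.eq (t + h) ⟨by linarith [hh.1], by linarith [hh.2]⟩ x, h1,
    heat_add (continuous_heat hφ hM _) (norm_heat_le hM _) h2 (abs_duhamel_le hK' t),
    duhamel_add (hu.continuous_source hp) hK' ht hh.1, h3]
  ring

/-- Applying `S(τ - h)` to the mild formula turns the free part into the constant `S(τ)φ` and the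
Duhamel part into `∫₀ʰ S(τ - s)N(u(s)) ds`, where `N` is the nonlinearity. No smoothness of `φ` is
needed. -/
lemma hasDerivWithinAt_heat (hp : 1 < p) (hu : IsMildSolution p φ δ u) (hφ : Continuous φ)
    {M : ℝ} (hM : ∀ x, |φ x| ≤ M) (hδ : 0 < δ) {τ : ℝ} (hτ : 0 < τ) (x : E) :
    HasDerivWithinAt (fun t => heat (√(2 * (τ - t))) (u t) x)
      (heat (√(2 * τ)) (fun y => signedPow p (φ y)) x) (Ioi 0) 0 := by
  obtain ⟨K, hK⟩ := hu.bounded_source hp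
  have hc := hu.continuous_source hp
  have hcs : ∀ s, Continuous fun y => signedPow p (u s y) := fun s =>
    hc.comp (Continuous.prodMk_right s)
  have hd := continuous_duhamel hc hK
  rw [hasDerivWithinAt_iff_tendsto_slope' (by simp)]
  let I : ℝ → ℝ := fun h => ∫ θ in Ioo (0 : ℝ) 1,
    heat (√(2 * (τ - h * θ))) (fun y => signedPow p (u (h * θ) y)) x
  have hIc : Continuous I := by
    have hk : Continuous fun q : ℝ × ℝ =>
        heat (√(2 * (τ - q.1 * q.2))) (fun y => signedPow p (u (q.1 * q.2) y)) x :=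
      continuous_heat_param (g := fun (q : ℝ × ℝ) y => signedPow p (u (q.1 * q.2) y))
        (by fun_prop) continuous_const
        (hc.comp (f := fun q : (ℝ × ℝ) × E => (q.1.1 * q.1.2, q.2)) (by fun_prop))
        fun _ => hK _
    refine continuous_of_dominated (bound := fun _ => K) ?_ ?_ ?_ ?_
    · exact fun h => (hk.comp (Continuous.prodMk_right h)).aestronglyMeasurable
    · exact fun h => ae_of_all _ fun θ => norm_heat_le (hK _) _ _
    · exact integrable_const _
    · exact ae_of_all _ fun θ => hk.comp (Continuous.prodMk_left θ)
  have hI0 : I 0 = heat (√(2 * τ)) (fun y => signedPow p (φ y)) x := by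
    simp only [I, zero_mul, sub_zero, hu.initial hδ.le]
    simp
  rw [← hI0]
  refine ((hIc.tendsto 0).mono_left nhdsWithin_le_nhds).congr' ?_
  filter_upwards [Ioo_mem_nhdsGT (lt_min hδ hτ)] with h hh
  have hh0 : 0 < h := hh.1
  have hhδ : h ≤ δ := hh.2.le.trans (min_le_left _ _)
  have hhτ : h ≤ τ := hh.2.le.trans (min_le_right _ _)
  have hτh : 0 ≤ 2 * (τ - h) := by linarith
  have h1 : u h = fun y => heat (√(2 * h)) φ y +
      duhamel (fun s y => signedPow p (u s y)) h y := funext fun y => hu.eq h ⟨hh0.le, hhδ⟩ y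
  have h2 : Continuous (duhamel (fun s y => signedPow p (u s y)) h) :=
    hd.comp (Continuous.prodMk_right h)
  have h3 : heat (√(2 * (τ - h))) (duhamel (fun s y => signedPow p (u s y)) h) x = h * I h := by
    rw [heat_duhamel hc hK, smul_eq_mul]
    congr 1
    refine setIntegral_congr_fun measurableSet_Ioo fun θ hθ => ?_
    have e1 : 0 ≤ h * (1 - θ) := mul_nonneg hh0.le (by linarith [hθ.2])
    refine heat_heat (ρ := √(2 * (τ - h * θ))) (hcs _) (hK _) ?_ x
    rw [Real.sq_sqrt (by nlinarith), Real.sq_sqrt hτh, Real.sq_sqrt (by positivity)]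
    ring
  have h4 : heat (√(2 * (τ - h))) (heat (√(2 * h)) φ) x = heat (√(2 * τ)) φ x := by
    refine heat_heat hφ hM ?_ x
    rw [Real.sq_sqrt (by positivity), Real.sq_sqrt hτh, Real.sq_sqrt (by positivity)]
    ring
  have h5 : u 0 = φ := funext fun y => hu.initial hδ.le y
  rw [slope_def_field, h5, h1,
    heat_add (continuous_heat hφ hM _) (norm_heat_le hM _) h2 (abs_duhamel_le hK h), h3, h4,
    sub_zero, sub_zero]
  field_simp
  ring

/-- For twice differentiable data the free part contributes the generator, and the Duhamel quotient
is an average `I h` that is continuous down to `h = 0`. -/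
lemma hasDerivWithinAt_zero (hp : 1 < p) (hu : IsMildSolution p φ δ u) (hδ : 0 < δ)
    {M : ℝ} (hM : ∀ x, |φ x| ≤ M) {φ' : E → E →L[ℝ] ℝ} {φ'' : E → E →L[ℝ] E →L[ℝ] ℝ} {C : ℝ}
    (hd : ∀ y, HasFDerivAt φ (φ' y) y) (hd' : ∀ y, HasFDerivAt φ' (φ'' y) y)
    (hC : ∀ y, ‖φ'' y‖ ≤ C) {ι : Type*} [Fintype ι] (b : OrthonormalBasis ι ℝ E) (x : E) :
    HasDerivWithinAt (fun t => u t x) (∑ i, φ'' x (b i) (b i) + signedPow p (φ x)) (Ioi 0) 0 := by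
  obtain ⟨K, hK⟩ := hu.bounded_source hp
  have hc := hu.continuous_source hp
  rw [hasDerivWithinAt_iff_tendsto_slope' (by simp)]
  let I : ℝ → ℝ := fun h => ∫ θ in Ioo (0 : ℝ) 1,
    heat (√(2 * (h * (1 - θ)))) (fun y => signedPow p (u (h * θ) y)) x
  have hIc : Continuous I := by
    have hk := (continuous_heat_duhamel hc hK).comp
      (f := fun q : ℝ × ℝ => ((q.1, x), q.2)) (by fun_prop)
    refine continuous_of_dominated (bound := fun _ => K) ?_ ?_ ?_ ?_
    · exact fun h => (hk.comp (Continuous.prodMk_right h)).aestronglyMeasurable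
    · exact fun h => ae_of_all _ fun θ => norm_heat_le (hK _) _ _
    · exact integrable_const _
    · exact ae_of_all _ fun θ => hk.comp (Continuous.prodMk_left θ)
  have hI0 : I 0 = signedPow p (φ x) := by
    simp only [I, zero_mul, mul_zero, Real.sqrt_zero, heat_zero, hu.initial hδ.le]
    simp
  rw [← hI0]
  refine ((tendsto_heat_sub_div hd hd' hM hC x b).add
    ((hIc.tendsto 0).mono_left nhdsWithin_le_nhds)).congr' ?_
  filter_upwards [Ioo_mem_nhdsGT hδ] with h hh
  have hh0 : h ≠ 0 := hh.1.ne'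
  rw [slope_def_field, hu.eq h ⟨hh.1.le, hh.2.le⟩, hu.initial hδ.le, duhamel]
  simp only [I, smul_eq_mul, sub_zero]
  field_simp
  ring

end IsMildSolution

end Mild

/-! ### Second derivatives as bilinear and as multilinear maps. -/

section SecondDerivative

variable {E : Type*} [NormedAddCommGroup E] [NormedSpace ℝ E]
  {W : Type*} [NormedAddCommGroup W] [NormedSpace ℝ W]

lemma contDiff_two_of_hasFDerivAt {g : E → W} {g' : E → E →L[ℝ] W} {g'' : E → E →L[ℝ] E →L[ℝ] W}
    (h1 : ∀ x, HasFDerivAt g (g' x) x) (h2 : ∀ x, HasFDerivAt g' (g'' x) x)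
    (hc : Continuous g'') : ContDiff ℝ 2 g := by
  have h3 : ContDiff ℝ 1 g' := contDiff_one_iff_hasFDerivAt.2 ⟨g'', hc, h2⟩
  have h4 : ContDiff ℝ ((1 : ℕ) + 1) g := contDiff_succ_iff_hasFDerivAt.2 ⟨g', h3, h1⟩
  norm_num at h4
  exact h4

lemma ContDiff.hasFDerivAt_fderiv {g : E → W} (h : ContDiff ℝ 2 g) (x : E) :
    HasFDerivAt (fderiv ℝ g) (fderiv ℝ (fderiv ℝ g) x) x := by
  have h1 : ContDiff ℝ 1 (fderiv ℝ g) := h.fderiv_right (by norm_num)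
  exact (h1.differentiable one_ne_zero x).hasFDerivAt

variable (E W) in
/-- Bilinear maps as multilinear maps in two variables. -/
noncomputable def bilinToMultilinear :
    (E →L[ℝ] E →L[ℝ] W) →L[ℝ] ContinuousMultilinearMap ℝ (fun _ : Fin 2 => E) W :=
  ((continuousMultilinearCurryLeftEquiv ℝ (fun _ : Fin 2 => E) W).symm :
      _ →L[ℝ] ContinuousMultilinearMap ℝ (fun _ : Fin 2 => E) W).comp
    (ContinuousLinearMap.compL ℝ E (E →L[ℝ] W) (ContinuousMultilinearMap ℝ (fun _ : Fin 1 => E) W)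
      ((continuousMultilinearCurryFin1 ℝ E W).symm : _ →L[ℝ] _))

lemma iteratedFDeriv_two_eq {g : E → W} {g' : E → E →L[ℝ] W} {H : E →L[ℝ] E →L[ℝ] W} {x : E}
    (h1 : ∀ x, HasFDerivAt g (g' x) x) (h2 : HasFDerivAt g' H x) :
    iteratedFDeriv ℝ 2 g x = bilinToMultilinear E W H := by
  have h3 : fderiv ℝ g = g' := funext fun y => (h1 y).fderiv
  ext m
  rw [iteratedFDeriv_two_apply, h3, h2.fderiv]
  rfl

end SecondDerivative

/-! ### Mild solutions are classical; the weak maximum principle. -/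

section Classical

variable {n : ℕ} {p : ℝ} {φ : RSpace n → ℝ} {δ : ℝ} {u : ℝ → RSpace n → ℝ}

lemma laplacian_eq_sum {g : RSpace n → ℝ} {g' : RSpace n → RSpace n →L[ℝ] ℝ}
    {H : RSpace n →L[ℝ] RSpace n →L[ℝ] ℝ} {x : RSpace n}
    (h1 : ∀ x, HasFDerivAt g (g' x) x) (h2 : HasFDerivAt g' H x) :
    Laplacian.laplacian g x = ∑ i, H (EuclideanSpace.basisFun (Fin n) ℝ i)
      (EuclideanSpace.basisFun (Fin n) ℝ i) := by
  have h3 : fderiv ℝ g = g' := funext fun y => (h1 y).fderiv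
  rw [InnerProductSpace.laplacian_eq_iteratedFDeriv_orthonormalBasis g
    (EuclideanSpace.basisFun (Fin n) ℝ)]
  simp only [iteratedFDeriv_two_apply, h3, h2.fderiv]
  rfl

/-- Bootstrap: a bounded source gives a gradient of size `1/√t`; by the chain rule the source then
has such a gradient too, which gives a continuous Hessian `v'`. -/
theorem IsMildSolution.isClassicalSolution (hp : 1 < p) (hφ : Continuous φ) {M : ℝ}
    (hM : ∀ x, |φ x| ≤ M) (hδ : 0 < δ) (hu : IsMildSolution p φ δ u) :
    IsClassicalSolution p φ δ u := by
  obtain ⟨K, hK⟩ := hu.bounded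
  have hsc := hu.continuous_source hp
  set F : ℝ → RSpace n → ℝ := fun s y => signedPow p (u s y)
  have hF : SqrtSingular F δ (K ^ p * √δ) := SqrtSingular.of_bounded hsc.continuousOn
    fun s _ y => abs_signedPow_le hp (hK s y)
  set v : ℝ → RSpace n → RSpace n →L[ℝ] ℝ := fun t x =>
    heatGrad (√(2 * t)) φ x + duhamelGrad F t x
  obtain ⟨K', hv⟩ : ∃ K', SqrtSingular v δ K' := sqrtSingular_mildGrad hφ hM hF
  have hd1 : ∀ t ∈ Ioo 0 δ, ∀ x, HasFDerivAt (u t) (v t x) x := fun t ht x => by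
    have h1 : u t = fun x => heat (√(2 * t)) φ x + duhamel F t x :=
      funext fun y => hu.eq t ⟨ht.1.le, ht.2.le⟩ y
    rw [h1]
    exact hasFDerivAt_mild hφ hM hF ht x
  set F' : ℝ → RSpace n → RSpace n →L[ℝ] ℝ := fun s y => (p * |u s y| ^ (p - 1)) • v s y
  have hFd : ∀ s ∈ Ioo 0 δ, ∀ x, HasFDerivAt (F s) (F' s x) x := fun s hs x =>
    (hasDerivAt_signedPow hp (u s x)).comp_hasFDerivAt x (hd1 s hs x)
  have hF' : SqrtSingular F' δ (p * K ^ (p - 1) * K') := by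
    refine ⟨ContinuousOn.smul (f := fun z : ℝ × RSpace n => p * |u z.1 z.2| ^ (p - 1)) ?_ hv.cont, fun s hs x => ?_⟩
    · refine Continuous.continuousOn (continuous_const.mul ?_)
      exact hu.continuous.abs.rpow_const fun _ => Or.inr (by linarith)
    · rw [norm_smul, mul_assoc]
      exact mul_le_mul (abs_deriv_signedPow_le hp (hK s x)) (hv.bound s hs x) (norm_nonneg _)
        ((abs_nonneg _).trans (abs_deriv_signedPow_le hp (hK s x)))
  set v' : ℝ → RSpace n → RSpace n →L[ℝ] RSpace n →L[ℝ] ℝ := fun t x =>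
    heatGrad (√t) (heatGrad (√t) φ) x + duhamelGrad F' t x
  have hd2 : ∀ t ∈ Ioo 0 δ, ∀ x, HasFDerivAt (v t) (v' t x) x := fun t ht x =>
    hasFDerivAt_mildGrad hφ hM hF hF' hFd ht x
  have hv'c : ContinuousOn (fun z : ℝ × RSpace n => v' z.1 z.2) (Ioo 0 δ ×ˢ univ) :=
    continuousOn_mildHess hφ hM hF'
  have hlap : ∀ t ∈ Ioo 0 δ, ∀ x, Laplacian.laplacian (u t) x =
      ∑ i, v' t x (EuclideanSpace.basisFun (Fin n) ℝ i) (EuclideanSpace.basisFun (Fin n) ℝ i) :=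
    fun t ht x => laplacian_eq_sum (hd1 t ht) (hd2 t ht x)
  refine ⟨hu.continuous.continuousOn, hu.initial hδ.le, fun t ht => ?_, ?_, ?_, fun t ht x => ?_,
    fun T' _ => ⟨K, fun t _ => hK t⟩⟩
  · refine contDiff_two_of_hasFDerivAt (hd1 t ht) (hd2 t ht) ?_
    rw [← continuousOn_univ]
    exact hv'c.comp (f := fun x => (t, x)) (by fun_prop) fun x _ => ⟨ht, mem_univ _⟩
  · exact hv.cont.congr fun z hz => (hd1 z.1 hz.1 z.2).fderiv
  · refine ((bilinToMultilinear (RSpace n) ℝ).continuous.comp_continuousOn hv'c).congr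
      fun z hz => ?_
    exact iteratedFDeriv_two_eq (hd1 z.1 hz.1) (hd2 z.1 hz.1 z.2)
  · rw [hlap t ht x]
    refine hasDerivAt_of_continuousOn_right_deriv (a := 0) (b := δ)
      (R := fun t => ∑ i, v' t x (EuclideanSpace.basisFun (Fin n) ℝ i)
        (EuclideanSpace.basisFun (Fin n) ℝ i) + |u t x| ^ (p - 1) * u t x) ?_ ?_ ?_ ht
    · exact (hu.continuous.comp (Continuous.prodMk_left x)).continuousOn
    · refine ContinuousOn.add (continuousOn_finsetSum _ fun i _ => ?_)
        (hsc.comp (Continuous.prodMk_left x)).continuousOn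
      have h1 : ContinuousOn (fun t => v' t x) (Ioo 0 δ) :=
        hv'c.comp (f := fun t => (t, x)) (by fun_prop) fun t ht => ⟨ht, mem_univ _⟩
      exact (h1.clm_apply continuousOn_const).clm_apply continuousOn_const
    · intro s hs
      obtain ⟨C, hC⟩ := exists_norm_mildHess_le (φ := φ) hM hF' hs
      -- After a restart at time `s > 0` the datum `u s` has a bounded Hessian, so the right
      -- derivative at zero can be computed.
      have h1 := (hu.shift hp hφ hM hs.1.le hs.2.le).hasDerivWithinAt_zero hp
        (sub_pos.2 hs.2) (hK s) (hd1 s hs) (hd2 s hs) hC (EuclideanSpace.basisFun (Fin n) ℝ) x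
      have h2 : HasDerivWithinAt (fun r : ℝ => r - s) 1 (Ioi s) s :=
        ((hasDerivAt_id s).sub_const s).hasDerivWithinAt
      rw [← sub_self s] at h1
      have h3 := HasDerivWithinAt.comp (h := fun r => r - s) s h1 h2 fun r hr => by
        rw [sub_self]
        exact sub_pos.2 (mem_Ioi.1 hr)
      simpa [Function.comp_def, signedPow] using h3

/-- At a maximum of `g - c‖·‖²` the gradient of `g` is that of `c‖·‖²`, and each pure second
derivative is at most `2c`. -/
lemma laplacian_le_of_le_add_norm_sq {g : RSpace n → ℝ} (hg : ContDiff ℝ 2 g) {x : RSpace n}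
    {c : ℝ} (h : ∀ y, g y - c * ‖y‖ ^ 2 ≤ g x - c * ‖x‖ ^ 2) :
    Laplacian.laplacian g x ≤ 2 * n * c := by
  have hd : ∀ y, HasFDerivAt g (fderiv ℝ g y) y := fun y =>
    (hg.differentiable (by norm_num) y).hasFDerivAt
  have hd' := hg.hasFDerivAt_fderiv x
  have hfirst : ∀ v, fderiv ℝ g x v = c * (2 * inner ℝ x v) := by
    have h1 : HasFDerivAt (fun y => g y - c * ‖y‖ ^ 2)
        (fderiv ℝ g x - c • (2 • innerSL ℝ x)) x :=
      (hd x).sub ((hasStrictFDerivAt_norm_sq x).hasFDerivAt.const_mul c)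
    have h2 : IsLocalMax (fun y => g y - c * ‖y‖ ^ 2) x := Eventually.of_forall h
    have h3 := h2.hasFDerivAt_eq_zero h1
    intro v
    have h4 := congrArg (fun L : RSpace n →L[ℝ] ℝ => L v) h3
    simp at h4
    linarith
  have hsecond : ∀ v : RSpace n, ‖v‖ = 1 → fderiv ℝ (fderiv ℝ g) x v v ≤ 2 * c := by
    intro v hv
    have h1 := tendsto_second_order_quotient hd hd' v
    have h2 : fderiv ℝ (fderiv ℝ g) x v v / 2 ≤ c := by
      refine le_of_tendsto h1 ?_
      filter_upwards [self_mem_nhdsWithin] with s hs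
      have hs : 0 < s := hs
      rw [inv_mul_le_iff₀ (by positivity), hfirst]
      have h3 := h (x + s • v)
      rw [norm_add_sq_real, norm_smul, hv, mul_one, real_inner_smul_right, Real.norm_eq_abs,
        sq_abs] at h3
      linarith
    linarith
  rw [laplacian_eq_sum hd hd']
  refine (Finset.sum_le_sum fun i _ => hsecond _
    ((EuclideanSpace.basisFun (Fin n) ℝ).orthonormal.1 i)).trans (le_of_eq ?_)
  simp
  ring

/-- Weak maximum principle on `ℝⁿ × [0, T]` for functions bounded above. -/
theorem nonpos_of_parabolic {T K M : ℝ} {w w' : ℝ → RSpace n → ℝ}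
    (hc : ContinuousOn (fun z : ℝ × RSpace n => w z.1 z.2) (Icc 0 T ×ˢ univ))
    (hM : ∀ t ∈ Icc 0 T, ∀ x, w t x ≤ M) (h0 : ∀ x, w 0 x ≤ 0)
    (hC2 : ∀ t ∈ Ioc 0 T, ContDiff ℝ 2 (w t))
    (hd : ∀ t ∈ Ioc 0 T, ∀ x, HasDerivAt (fun s => w s x) (w' t x) t)
    (hle : ∀ t ∈ Ioc 0 T, ∀ x, 0 < w t x → w' t x ≤ Laplacian.laplacian (w t) x + K * w t x) :
    ∀ t ∈ Icc 0 T, ∀ x, w t x ≤ 0 := by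
  by_contra! hcon
  obtain ⟨t₁, ht₁, x₁, hpos⟩ := hcon
  have hT : 0 ≤ T := ht₁.1.trans ht₁.2
  set A : ℝ := ‖x₁‖ ^ 2 + (2 * n + 1) * t₁ + 1
  have hA : 0 < A := by
    have := ht₁.1
    positivity
  -- `A` is the barrier at `(t₁, x₁)`, and this `ε` spends exactly half of the positive value there,
  -- so `z` stays positive.
  set ε : ℝ := Real.exp (-K * t₁) * w t₁ x₁ / (2 * A) with hε
  have hε0 : 0 < ε := by positivity
  let z : ℝ × RSpace n → ℝ := fun q =>
    Real.exp (-K * q.1) * w q.1 q.2 - ε * (‖q.2‖ ^ 2 + (2 * n + 1) * q.1 + 1)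
  have hz1 : 0 < z (t₁, x₁) := by
    have h1 : ε * A = Real.exp (-K * t₁) * w t₁ x₁ / 2 := by
      rw [hε]; field_simp
    have h2 : 0 < Real.exp (-K * t₁) * w t₁ x₁ := by positivity
    have h3 : z (t₁, x₁) = Real.exp (-K * t₁) * w t₁ x₁ - ε * A := rfl
    rw [h3, h1]
    linarith
  set B : ℝ := Real.exp (|K| * T) * max M 0
  have hB0 : 0 ≤ B := by positivity
  have hB : ∀ t ∈ Icc 0 T, ∀ x, Real.exp (-K * t) * w t x ≤ B := by
    intro t ht x
    have h1 : Real.exp (-K * t) ≤ Real.exp (|K| * T) := by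
      rw [Real.exp_le_exp]
      calc -K * t ≤ |K| * t := mul_le_mul_of_nonneg_right (neg_le_abs K) ht.1
        _ ≤ |K| * T := mul_le_mul_of_nonneg_left ht.2 (abs_nonneg _)
    calc _ ≤ Real.exp (-K * t) * max M 0 := by
          gcongr
          exact (hM t ht x).trans (le_max_left _ _)
      _ ≤ B := mul_le_mul_of_nonneg_right h1 (le_max_right _ _)
  -- Outside this radius the quadratic barrier beats the bound `B`, so the maximum over the compact
  -- cylinder is global.
  set ρ : ℝ := max ‖x₁‖ (√(B / ε))
  have hρ : B ≤ ε * ρ ^ 2 := by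
    have h1 : √(B / ε) ≤ ρ := le_max_right _ _
    have h2 : B / ε ≤ ρ ^ 2 := by
      rw [← Real.sq_sqrt (by positivity : 0 ≤ B / ε)]
      gcongr
    rw [div_le_iff₀ hε0] at h2
    linarith
  have hzc : ContinuousOn z (Icc 0 T ×ˢ univ) := by
    refine ContinuousOn.sub (ContinuousOn.mul ?_ hc) ?_ <;> fun_prop
  obtain ⟨⟨t₀, x₀⟩, hmem, hmax⟩ :=
    (isCompact_Icc.prod (isCompact_closedBall (0 : RSpace n) ρ)).exists_isMaxOn ⟨(t₁, x₁), ht₁, by simp [ρ]⟩ (hzc.mono (prod_mono_right (subset_univ _)))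
  have ht₀ : t₀ ∈ Icc 0 T := hmem.1
  have hz0 : 0 < z (t₀, x₀) := hz1.trans_le (hmax ⟨ht₁, by simp [ρ]⟩)
  have hglob : ∀ t ∈ Icc 0 T, ∀ x, z (t, x) ≤ z (t₀, x₀) := by
    intro t ht x
    by_cases hx : ‖x‖ ≤ ρ
    · exact hmax ⟨ht, by simpa using hx⟩
    · refine le_trans ?_ hz0.le
      have h1 := hB t ht x
      have h2 : ρ ^ 2 ≤ ‖x‖ ^ 2 := by
        have : 0 ≤ ρ := (norm_nonneg _).trans (le_max_left _ _)
        have h3 : ρ ≤ ‖x‖ := (not_le.1 hx).le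
        gcongr
      have h3 : ε * ρ ^ 2 ≤ ε * ‖x‖ ^ 2 := by gcongr
      have h4 : 0 ≤ ε * ((2 * n + 1) * t + 1) := by
        have := ht.1
        positivity
      simp only [z]
      linarith
  have ht₀pos : 0 < t₀ := by
    refine ht₀.1.lt_of_ne fun h => ?_
    subst h
    have h1 := h0 x₀
    have h2 : 0 ≤ ε * (‖x₀‖ ^ 2 + 1) := by positivity
    simp only [z, mul_zero, Real.exp_zero, one_mul, add_zero] at hz0
    linarith
  have ht₀' : t₀ ∈ Ioc 0 T := ⟨ht₀pos, ht₀.2⟩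
  have hexp : 0 < Real.exp (-K * t₀) := Real.exp_pos _
  have hw0 : 0 < w t₀ x₀ := by
    have h1 : 0 ≤ ε * (‖x₀‖ ^ 2 + (2 * n + 1) * t₀ + 1) := by positivity
    have h2 : 0 < Real.exp (-K * t₀) * w t₀ x₀ := by
      simp only [z] at hz0
      linarith
    exact pos_of_mul_pos_right h2 hexp.le
  have hlap : Laplacian.laplacian (w t₀) x₀ ≤ 2 * n * (ε / Real.exp (-K * t₀)) := by
    refine laplacian_le_of_le_add_norm_sq (hC2 t₀ ht₀') fun y => ?_
    have h1 := hglob t₀ ht₀ y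
    simp only [z] at h1
    have h2 : Real.exp (-K * t₀) * w t₀ y - ε * ‖y‖ ^ 2 ≤
        Real.exp (-K * t₀) * w t₀ x₀ - ε * ‖x₀‖ ^ 2 := by linarith
    have h3 : ∀ y, w t₀ y - ε / Real.exp (-K * t₀) * ‖y‖ ^ 2 =
        (Real.exp (-K * t₀) * w t₀ y - ε * ‖y‖ ^ 2) / Real.exp (-K * t₀) := by
      intro y
      field_simp
    rw [h3, h3]
    gcongr
  have htime : 0 ≤ Real.exp (-K * t₀) * (w' t₀ x₀ - K * w t₀ x₀) - ε * (2 * n + 1) := by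
    have h1 : HasDerivAt (fun s => z (s, x₀))
        (Real.exp (-K * t₀) * (w' t₀ x₀ - K * w t₀ x₀) - ε * (2 * n + 1)) t₀ := by
      have e1 : HasDerivAt (fun s : ℝ => Real.exp (-K * s)) (Real.exp (-K * t₀) * -K) t₀ := by
        simpa using ((hasDerivAt_id t₀).const_mul (-K)).exp
      have e2 : HasDerivAt (fun s : ℝ => ε * (‖x₀‖ ^ 2 + (2 * n + 1) * s + 1))
          (ε * (2 * n + 1)) t₀ := by
        simpa using ((((hasDerivAt_id t₀).const_mul (2 * n + 1 : ℝ)).const_add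
          (‖x₀‖ ^ 2)).add_const 1).const_mul ε
      refine ((e1.mul (hd t₀ ht₀' x₀)).sub e2).congr_deriv ?_
      ring
    -- Only quotients from the left are used, since `t₀ = T` is possible.
    have h2 := (hasDerivAt_iff_tendsto_slope.1 h1).mono_left (nhdsLT_le_nhdsNE t₀)
    refine ge_of_tendsto h2 ?_
    filter_upwards [Ioo_mem_nhdsLT ht₀pos] with s hs
    rw [slope_def_field]
    refine div_nonneg_of_nonpos ?_ (by linarith [hs.2])
    have := hglob s ⟨hs.1.le, hs.2.le.trans ht₀.2⟩ x₀
    linarith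
  have h1 := hle t₀ ht₀' x₀ hw0
  -- The slope `2n + 1` of the barrier in time exceeds the `2n` produced by its Laplacian, which is
  -- the contradiction.
  have h2 : Real.exp (-K * t₀) * (w' t₀ x₀ - K * w t₀ x₀) ≤ 2 * n * ε := by
    calc _ ≤ Real.exp (-K * t₀) * (2 * n * (ε / Real.exp (-K * t₀))) := by
          gcongr
          linarith
      _ = _ := by field_simp
  linarith

end Classical

/-! ### Classical solutions: comparison, gluing, the Jensen inequality argument. -/

namespace IsClassicalSolution

variable {n : ℕ} {p T S : ℝ} {φ ψ : RSpace n → ℝ} {u v : ℝ → RSpace n → ℝ}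

lemma continuous_apply (hu : IsClassicalSolution p φ T u) {t : ℝ} (ht : t ∈ Ico 0 T) :
    Continuous (u t) := by
  rw [← continuousOn_univ]
  exact hu.continuousOn.comp (f := fun x => (t, x)) (by fun_prop) fun x _ => ⟨ht, mem_univ _⟩

/-- Where `u - v > 0`, the difference of the nonlinearities is at most a local Lipschitz constant
times `u - v`, so the maximum principle applies to `u - v`. -/
lemma le_of_initial_le (hp : 1 < p) (hu : IsClassicalSolution p φ T u)
    (hv : IsClassicalSolution p ψ S v) (h : ∀ x, φ x ≤ ψ x) {t : ℝ} (h0 : 0 ≤ t) (htT : t < T)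
    (htS : t < S) (x : RSpace n) : u t x ≤ v t x := by
  obtain ⟨M₁, hM₁⟩ := hu.bounded t htT
  obtain ⟨M₂, hM₂⟩ := hv.bounded t htS
  set R := max M₁ M₂
  have hT : ∀ s ∈ Ioc 0 t, s ∈ Ioo 0 T := fun s hs => ⟨hs.1, hs.2.trans_lt htT⟩
  have hS : ∀ s ∈ Ioc 0 t, s ∈ Ioo 0 S := fun s hs => ⟨hs.1, hs.2.trans_lt htS⟩
  have key := nonpos_of_parabolic (T := t) (K := p * R ^ (p - 1)) (M := M₁ + M₂)
    (w := fun s y => u s y - v s y)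
    (w' := fun s y => (Laplacian.laplacian (u s) y + |u s y| ^ (p - 1) * u s y) -
      (Laplacian.laplacian (v s) y + |v s y| ^ (p - 1) * v s y)) ?_ ?_ ?_ ?_ ?_ ?_ t ⟨h0, le_rfl⟩ x
  · linarith
  · exact (hu.continuousOn.mono (prod_mono_left fun s hs => ⟨hs.1, hs.2.trans_lt htT⟩)).sub
      (hv.continuousOn.mono (prod_mono_left fun s hs => ⟨hs.1, hs.2.trans_lt htS⟩))
  · intro s hs y
    have h1 := (abs_le.1 (hM₁ s hs y)).2
    have h2 := (abs_le.1 (hM₂ s hs y)).1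
    linarith
  · intro y
    rw [hu.initial, hv.initial]
    linarith [h y]
  · exact fun s hs => (hu.contDiff s (hT s hs)).sub (hv.contDiff s (hS s hs))
  · exact fun s hs y => (hu.equation s (hT s hs) y).sub (hv.equation s (hS s hs) y)
  · intro s hs y hpos
    have h1 := ContDiffAt.laplacian_sub (hu.contDiff s (hT s hs)).contDiffAt
      (hv.contDiff s (hS s hs)).contDiffAt (x := y)
    have h2 : (fun y => u s y - v s y) = u s - v s := rfl
    have h3 := abs_signedPow_sub_le hp (R := R)
      ((hM₁ s ⟨hs.1.le, hs.2⟩ y).trans (le_max_left _ _))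
      ((hM₂ s ⟨hs.1.le, hs.2⟩ y).trans (le_max_right _ _))
    rw [abs_of_pos hpos] at h3
    have h4 := (le_abs_self _).trans h3
    simp only [signedPow] at h4
    rw [h2, h1]
    linarith

lemma eq_of_mem (hp : 1 < p) (hu : IsClassicalSolution p φ T u)
    (hv : IsClassicalSolution p φ S v) {t : ℝ} (h0 : 0 ≤ t) (htT : t < T) (htS : t < S) :
    u t = v t :=
  funext fun x => le_antisymm (hu.le_of_initial_le hp hv (fun _ => le_rfl) h0 htT htS x)
    (hv.le_of_initial_le hp hu (fun _ => le_rfl) h0 htS htT x)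

lemma zero (p T : ℝ) :
    IsClassicalSolution p (fun _ : RSpace n => 0) T (fun _ _ => 0) := by
  refine ⟨continuousOn_const, fun _ => rfl, fun _ _ => contDiff_const, ?_, ?_, fun t _ x => ?_,
    fun _ _ => ⟨0, fun _ _ _ => by simp⟩⟩
  · simpa using continuousOn_const
  · refine (continuousOn_const (c := 0)).congr fun z _ => ?_
    exact congrFun (iteratedFDeriv_fun_zero (𝕜 := ℝ) (E := RSpace n) (F := ℝ)) z.2
  · have h1 : Laplacian.laplacian (fun _ : RSpace n => (0 : ℝ)) x = 0 := by
      rw [InnerProductSpace.laplacian_const]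
      rfl
    rw [h1]
    simpa using hasDerivAt_const t (0 : ℝ)

lemma nonneg (hp : 1 < p) (hu : IsClassicalSolution p φ T u) (h : ∀ x, 0 ≤ φ x) {t : ℝ}
    (ht : t ∈ Ico 0 T) (x : RSpace n) : 0 ≤ u t x :=
  (zero p T).le_of_initial_le hp hu h ht.1 ht.2 ht.2 x

/-- Being a classical solution is a local property in positive time. -/
lemma of_local (h0 : ∀ x, u 0 x = φ x)
    (hb : ∀ T' < T, ∃ M : ℝ, ∀ t ∈ Icc 0 T', ∀ x, |u t x| ≤ M)
    (hc : ∀ x, ContinuousWithinAt (fun z : ℝ × RSpace n => u z.1 z.2) (Ico 0 T ×ˢ univ) (0, x))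
    (hloc : ∀ t ∈ Ioo 0 T, ∃ (ψ : RSpace n → ℝ) (S : ℝ) (v : ℝ → RSpace n → ℝ) (c : ℝ),
      IsClassicalSolution p ψ S v ∧ t - c ∈ Ioo 0 S ∧ ∀ᶠ s in 𝓝 t, u s = v (s - c)) :
    IsClassicalSolution p φ T u := by
  have hlift : ∀ {Y : Type} [TopologicalSpace Y] (G : (RSpace n → ℝ) → RSpace n → Y)
      {v : ℝ → RSpace n → ℝ} {S c t : ℝ} (x : RSpace n),
      ContinuousOn (fun z : ℝ × RSpace n => G (v z.1) z.2) (Ioo 0 S ×ˢ univ) → t - c ∈ Ioo 0 S →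
      (∀ᶠ s in 𝓝 t, u s = v (s - c)) →
      ContinuousAt (fun z : ℝ × RSpace n => G (u z.1) z.2) (t, x) := by
    intro Y _ G v S c t x hG ht hev
    have h1 : ContinuousAt (fun z : ℝ × RSpace n => G (v z.1) z.2) (t - c, x) :=
      hG.continuousAt ((isOpen_Ioo.prod isOpen_univ).mem_nhds ⟨ht, mem_univ _⟩)
    have h2 : ContinuousAt (fun z : ℝ × RSpace n => G (v (z.1 - c)) z.2) (t, x) :=
      ContinuousAt.comp (g := fun z : ℝ × RSpace n => G (v z.1) z.2)
        (f := fun z : ℝ × RSpace n => (z.1 - c, z.2)) (x := (t, x)) h1 (by fun_prop)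
    refine h2.congr ?_
    filter_upwards [continuousAt_fst.eventually hev] with z hz
    rw [hz]
  refine ⟨?_, h0, fun t ht => ?_, ?_, ?_, fun t ht x => ?_, hb⟩
  · rintro ⟨t, x⟩ ⟨ht, -⟩
    have ht : t ∈ Ico 0 T := ht
    rcases ht.1.eq_or_lt with h | h
    · rw [← h]
      exact hc x
    · obtain ⟨ψ, S, v, c, hv, hmem, hev⟩ := hloc t ⟨h, ht.2⟩
      exact (hlift (fun g y => g y) x (hv.continuousOn.mono (prod_mono_left Ioo_subset_Ico_self))
        hmem hev).continuousWithinAt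
  · obtain ⟨ψ, S, v, c, hv, hmem, hev⟩ := hloc t ht
    rw [hev.self_of_nhds]
    exact hv.contDiff _ hmem
  · rintro ⟨t, x⟩ ⟨ht, -⟩
    obtain ⟨ψ, S, v, c, hv, hmem, hev⟩ := hloc t ht
    exact (hlift (fun g y => fderiv ℝ g y) x hv.continuousOn_fderiv hmem hev).continuousWithinAt
  · rintro ⟨t, x⟩ ⟨ht, -⟩
    obtain ⟨ψ, S, v, c, hv, hmem, hev⟩ := hloc t ht
    exact (hlift (fun g y => iteratedFDeriv ℝ 2 g y) x hv.continuousOn_fderiv_two hmem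
      hev).continuousWithinAt
  · obtain ⟨ψ, S, v, c, hv, hmem, hev⟩ := hloc t ht
    rw [hev.self_of_nhds]
    refine ((hv.equation _ hmem x).comp_sub_const t c).congr_of_eventuallyEq ?_
    filter_upwards [hev] with s hs
    rw [hs]

lemma shift (hu : IsClassicalSolution p φ T u) {t₀ : ℝ} (ht₀ : t₀ ∈ Ico 0 T) :
    IsClassicalSolution p (u t₀) (T - t₀) (fun s => u (t₀ + s)) := by
  refine of_local (fun x => by simp) (fun T' hT' => ?_) (fun x => ?_) fun t ht => ?_
  · obtain ⟨M, hM⟩ := hu.bounded (t₀ + T') (by linarith)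
    exact ⟨M, fun t ht => hM _ ⟨by linarith [ht.1, ht₀.1], by linarith [ht.2]⟩⟩
  · have h1 := hu.continuousOn (t₀ + 0, x) ⟨by simpa using ht₀, mem_univ _⟩
    refine ContinuousWithinAt.comp (g := fun z : ℝ × RSpace n => u z.1 z.2)
      (f := fun z : ℝ × RSpace n => (t₀ + z.1, z.2)) (x := (0, x)) h1 (by fun_prop) ?_
    rintro ⟨s, y⟩ ⟨hs, -⟩
    exact ⟨⟨add_nonneg ht₀.1 hs.1, lt_sub_iff_add_lt'.1 hs.2⟩, mem_univ _⟩
  · refine ⟨φ, T, u, -t₀, hu, ⟨?_, ?_⟩, Eventually.of_forall fun s => ?_⟩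
    · linarith [ht.1, ht₀.1]
    · linarith [ht.2]
    · rw [sub_neg_eq_add, add_comm]

/-- By uniqueness the restarted solution agrees with `u` on `[t₀, T)`. Being a solution is local in
time, so this overlap suffices for gluing. -/
lemma exists_extension (hp : 1 < p) (hu : IsClassicalSolution p φ T u) {t₀ : ℝ}
    (ht₀ : t₀ ∈ Ioo 0 T) (hv : IsClassicalSolution p (u t₀) S v) (hS : T < t₀ + S) :
    ∃ w, IsClassicalSolution p φ (t₀ + S) w := by
  have hagree : ∀ s, t₀ ≤ s → s < T → u s = v (s - t₀) := fun s h1 h2 => by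
    have := (hu.shift ⟨ht₀.1.le, ht₀.2⟩).eq_of_mem hp hv (sub_nonneg.2 h1)
      (by linarith) (by linarith)
    simpa using this
  let w : ℝ → RSpace n → ℝ := fun s => if s < T then u s else v (s - t₀)
  have hw1 : ∀ s, s < T → w s = u s := fun s hs => if_pos hs
  have hw2 : ∀ s, t₀ ≤ s → w s = v (s - t₀) := fun s hs => by
    by_cases h : s < T
    · rw [hw1 s h, hagree s hs h]
    · exact if_neg h
  have hT : 0 < T := ht₀.1.trans ht₀.2
  refine ⟨w, of_local (fun x => ?_) (fun T' hT' => ?_) (fun x => ?_) fun t ht => ?_⟩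
  · rw [hw1 0 hT, hu.initial]
  · obtain ⟨M₁, hM₁⟩ := hu.bounded t₀ ht₀.2
    obtain ⟨M₂, hM₂⟩ := hv.bounded (T' - t₀) (by linarith)
    refine ⟨max M₁ M₂, fun t ht x => ?_⟩
    rcases le_total t t₀ with h | h
    · rw [hw1 t (h.trans_lt ht₀.2)]
      exact (hM₁ t ⟨ht.1, h⟩ x).trans (le_max_left _ _)
    · rw [hw2 t h]
      exact (hM₂ _ ⟨sub_nonneg.2 h, by linarith [ht.2]⟩ x).trans (le_max_right _ _)
  · have h1 := hu.continuousOn (0, x) ⟨⟨le_rfl, hT⟩, mem_univ _⟩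
    have hnear : ∀ᶠ z : ℝ × RSpace n in 𝓝 (0, x), z.1 < T :=
      continuousAt_fst.eventually (gt_mem_nhds hT)
    have h2 : ContinuousWithinAt (fun z : ℝ × RSpace n => u z.1 z.2)
        (Ico 0 (t₀ + S) ×ˢ univ) (0, x) := by
      refine h1.mono_of_mem_nhdsWithin ?_
      filter_upwards [self_mem_nhdsWithin, nhdsWithin_le_nhds hnear] with z hz hz'
      exact ⟨⟨hz.1.1, hz'⟩, mem_univ _⟩
    refine h2.congr_of_eventuallyEq ?_ (by rw [hw1 0 hT])
    filter_upwards [nhdsWithin_le_nhds hnear] with z hz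
    rw [hw1 _ hz]
  · by_cases h : t < T
    · refine ⟨φ, T, u, 0, hu, by simpa using ⟨ht.1, h⟩, ?_⟩
      filter_upwards [gt_mem_nhds h] with s hs
      rw [hw1 s hs, sub_zero]
    · have h' : t₀ < t := ht₀.2.trans_le (not_lt.1 h)
      refine ⟨u t₀, S, v, t₀, hv, ⟨by linarith, by linarith [ht.2]⟩, ?_⟩
      filter_upwards [lt_mem_nhds h'] with s hs using hw2 s hs.le

lemma exists_bound_apply (hu : IsClassicalSolution p φ T u) {t : ℝ} (ht : t ∈ Ico 0 T) :
    ∃ M > 0, ∀ x, |u t x| ≤ M := by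
  obtain ⟨M, hM⟩ := hu.bounded t ht.2
  exact ⟨max M 1, by positivity, fun x => (hM t ⟨ht.1, le_rfl⟩ x).trans (le_max_left _ _)⟩

/-- Classical solutions are mild on short time intervals. -/
lemma exists_isMildSolution_shift (hp : 1 < p) (hu : IsClassicalSolution p φ T u) {t₀ : ℝ}
    (ht₀ : t₀ ∈ Ico 0 T) : ∃ δ > 0, ∃ v, IsMildSolution p (u t₀) δ v ∧
      ∀ᶠ h in 𝓝[≥] 0, u (t₀ + h) = v h := by
  obtain ⟨M, hM, huM⟩ := hu.exists_bound_apply ht₀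
  obtain ⟨δ, hδ, hex⟩ := exists_isMildSolution (E := RSpace n) hp hM
  obtain ⟨v, hv⟩ := hex (u t₀) (hu.continuous_apply ht₀) huM
  refine ⟨δ, hδ, v, hv, ?_⟩
  have hvc := hv.isClassicalSolution hp (hu.continuous_apply ht₀) huM hδ
  filter_upwards [Ico_mem_nhdsGE (lt_min hδ (sub_pos.2 ht₀.2))] with h hh
  exact (hu.shift ht₀).eq_of_mem hp hvc hh.1 (hh.2.trans_le (min_le_right _ _))
    (hh.2.trans_le (min_le_left _ _))

/-- The blow-up mechanism: `H` runs from `S(τ)φ(x)` to `u(τ, x)` and satisfies `H' ≥ H^p` in the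
sense of right derivatives. -/
lemma mul_le_heat_rpow (hp : 1 < p) (hu : IsClassicalSolution p φ T u) (hφ : ∀ x, 0 ≤ φ x)
    {τ : ℝ} (hτ : τ ∈ Ioo 0 T) {x : RSpace n} (hpos : 0 < heat (√(2 * τ)) φ x) :
    (p - 1) * τ ≤ heat (√(2 * τ)) φ x ^ (1 - p) := by
  obtain ⟨M, hM⟩ := hu.bounded τ hτ.2
  set H : ℝ → ℝ := fun t => heat (√(2 * (τ - t))) (u t) x with hH
  have hH0 : H 0 = heat (√(2 * τ)) φ x := by
    simp only [hH, sub_zero]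
    congr 1
    exact funext hu.initial
  have hHc : ContinuousOn H (Icc 0 τ) := by
    let c : ℝ → ℝ := fun t => max 0 (min t τ)
    have hcmem : ∀ t, c t ∈ Icc 0 τ := fun t =>
      ⟨le_max_left _ _, max_le hτ.1.le (min_le_right _ _)⟩
    have h1 : Continuous fun z : ℝ × RSpace n => u (c z.1) z.2 := by
      rw [← continuousOn_univ]
      refine hu.continuousOn.comp (f := fun z : ℝ × RSpace n => (c z.1, z.2)) (by fun_prop) ?_
      exact fun z _ => ⟨⟨(hcmem _).1, (hcmem _).2.trans_lt hτ.2⟩, mem_univ _⟩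
    have h2 : Continuous fun t => heat (√(2 * (τ - t))) (u (c t)) x :=
      continuous_heat_param (g := fun t => u (c t)) (by fun_prop) continuous_const h1
        fun t => hM _ (hcmem t)
    refine h2.continuousOn.congr fun t ht => ?_
    simp only [hH, c]
    rw [min_eq_left ht.2, max_eq_right ht.1]
  set D : ℝ → ℝ := fun t => heat (√(2 * (τ - t))) (fun y => signedPow p (u t y)) x
  have hmem : ∀ t ∈ Ico 0 τ, t ∈ Ico 0 T := fun t ht => ⟨ht.1, ht.2.trans hτ.2⟩
  have hHd : ∀ t ∈ Ico 0 τ, HasDerivWithinAt H (D t) (Ici t) t := by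
    intro t ht
    obtain ⟨δ, hδ, v, hv, hev⟩ := hu.exists_isMildSolution_shift hp (hmem t ht)
    have h1 := hv.hasDerivWithinAt_heat hp (hu.continuous_apply (hmem t ht))
      (hM t ⟨ht.1, ht.2.le⟩) hδ (sub_pos.2 ht.2) x
    have h2 : HasDerivWithinAt (fun h => H (t + h)) (D t) (Ioi 0) 0 := by
      refine h1.congr_of_eventuallyEq ?_ ?_
      · filter_upwards [nhdsWithin_mono _ Ioi_subset_Ici_self hev] with h hh
        simp only [hH]
        rw [hh, sub_sub]
      · simp only [hH, add_zero, sub_zero]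
        congr 1
        exact (funext fun y => hv.initial hδ.le y).symm
    rw [← sub_self t] at h2
    rw [← hasDerivWithinAt_Ioi_iff_Ici]
    have h3 : HasDerivWithinAt (fun r : ℝ => r - t) 1 (Ioi t) t :=
      ((hasDerivAt_id t).sub_const t).hasDerivWithinAt
    have h4 := HasDerivWithinAt.comp (h := fun r => r - t) t h2 h3 fun r hr => by
      rw [sub_self]
      exact sub_pos.2 (mem_Ioi.1 hr)
    simpa [Function.comp_def] using h4
  have hnn : ∀ t ∈ Ico 0 τ, ∀ y, 0 ≤ u t y := fun t ht y => hu.nonneg hp hφ (hmem t ht) y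
  have hDH : ∀ t ∈ Ico 0 τ, H t ^ p ≤ D t := by
    intro t ht
    have h1 := rpow_heat_le hp.le (hu.continuous_apply (hmem t ht)) (hnn t ht)
      (fun y => (le_abs_self _).trans (hM t ⟨ht.1, ht.2.le⟩ y)) (√(2 * (τ - t))) x
    have h2 : (fun y => u t y ^ p) = fun y => signedPow p (u t y) :=
      funext fun y => (signedPow_of_nonneg hp (hnn t ht y)).symm
    rwa [h2] at h1
  have hHnn : ∀ t ∈ Ico 0 τ, 0 ≤ H t := fun t ht =>
    integral_nonneg fun z => hnn t ht _
  -- `H` is nondecreasing and starts at a positive value; positivity is needed to differentiate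
  -- `H^(1-p)`.
  have hHpos : ∀ t ∈ Icc 0 τ, 0 < H t := by
    intro t ht
    have h1 := image_le_of_deriv_right_le_deriv_boundary (f := fun t => -H t)
      (f' := fun t => -D t) (a := 0) (b := τ) (B := fun _ => -H 0) (B' := fun _ => 0) hHc.neg
      (fun s hs => (hHd s hs).neg) le_rfl continuousOn_const
      (fun s _ => hasDerivWithinAt_const _ _ _)
      (fun s hs => neg_nonpos.2 ((Real.rpow_nonneg (hHnn s hs) p).trans (hDH s hs))) ht
    have h2 : H 0 ≤ H t := neg_le_neg_iff.1 h1
    exact (hH0 ▸ hpos).trans_le h2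
  have hfinal := image_le_of_deriv_right_le_deriv_boundary (f := fun t => H t ^ (1 - p))
    (f' := fun t => D t * (1 - p) * H t ^ (1 - p - 1)) (a := 0) (b := τ)
    (B := fun t => H 0 ^ (1 - p) - (p - 1) * t) (B' := fun _ => -(p - 1))
    (hHc.rpow_const fun t ht => Or.inl (hHpos t ht).ne')
    (fun s hs => (hHd s hs).rpow_const (Or.inl (hHpos s (Ico_subset_Icc_self hs)).ne'))
    (by simp) (by fun_prop)
    (fun s _ => by
      simpa using (((hasDerivAt_id s).const_mul (p - 1)).const_sub
        (H 0 ^ (1 - p))).hasDerivWithinAt)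
    (fun s hs => by
      have h1 := hHpos s (Ico_subset_Icc_self hs)
      have h2 : H s ^ p * H s ^ (1 - p - 1) = 1 := by
        rw [← Real.rpow_add h1]
        simp
      have h3 : 1 ≤ D s * H s ^ (1 - p - 1) := by
        exact h2.ge.trans (mul_le_mul_of_nonneg_right (hDH s hs) (Real.rpow_nonneg h1.le _))
      nlinarith) (right_mem_Icc.2 hτ.1.le)
  -- The endpoint term `H(τ)^(1-p)` is positive and can be dropped.
  have h1 := Real.rpow_pos_of_pos (hHpos τ (right_mem_Icc.2 hτ.1.le)) (1 - p)
  rw [← hH0]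
  linarith

end IsClassicalSolution

/-! ### Upper density and the supremum of the heat evolution. -/

section Density

variable {n : ℕ} {φ : RSpace n → ℝ} {α : ℝ}

lemma density_nonneg (r : ℝ) : 0 ≤ density φ α r :=
  Real.iSup_nonneg fun x => by positivity

lemma le_setIntegral_translate (hφc : Continuous φ) (hφ : ∀ x, 0 ≤ φ x) {M : ℝ}
    (hM : ∀ x, φ x ≤ M) {r s : ℝ} {y : RSpace n} (hy : ‖y‖ ≤ s) (x₀ : RSpace n) :
    α * volume.real (Metric.ball x₀ r ∩ {y | α ≤ φ y}) ≤
      ∫ x in Metric.ball x₀ (r + s), φ (x + y) := by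
  set A : Set (RSpace n) := Metric.ball x₀ r ∩ {y | α ≤ φ y}
  have hA : MeasurableSet A :=
    measurableSet_ball.inter (isClosed_le continuous_const hφc).measurableSet
  have hsub : (fun x => x + y) ⁻¹' A ⊆ Metric.ball x₀ (r + s) := by
    intro x hx
    have h1 : dist (x + y) x₀ < r := hx.1
    rw [Metric.mem_ball]
    calc dist x x₀ ≤ dist x (x + y) + dist (x + y) x₀ := dist_triangle _ _ _
      _ < s + r := by
          have : dist x (x + y) ≤ s := by simpa [dist_eq_norm] using hy
          linarith
      _ = r + s := add_comm _ _
  have hint : IntegrableOn (fun x => φ (x + y)) (Metric.ball x₀ (r + s)) := by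
    have : IsFiniteMeasure ((volume : Measure (RSpace n)).restrict (Metric.ball x₀ (r + s))) :=
      ⟨by simpa using measure_ball_lt_top⟩
    refine Integrable.of_bound (Continuous.aestronglyMeasurable (by fun_prop)) M
      (ae_of_all _ fun x => ?_)
    rw [Real.norm_of_nonneg (hφ _)]
    exact hM _
  have hpre : MeasurableSet ((fun x => x + y) ⁻¹' A) := (measurable_add_const y) hA
  calc α * volume.real A = α * volume.real ((fun x => x + y) ⁻¹' A) := by
        rw [measureReal_def, measureReal_def, measure_preimage_add_right]
    _ ≤ ∫ x in (fun x => x + y) ⁻¹' A, φ (x + y) :=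
        setIntegral_ge_of_const_le_real hpre
          ((measure_mono hsub).trans_lt measure_ball_lt_top).ne (fun x hx => hx.2)
          (hint.mono_set hsub)
    _ ≤ _ := setIntegral_mono_set hint (ae_of_all _ fun x => hφ _) hsub.eventuallyLE

/-- Integrate `S(t)φ ≤ c` over the enlarged ball and apply Fubini. Gaussian shifts with `‖z‖ ≤ k`
displace by at most `σk`, so each such translate still sees all of `{φ ≥ α}` in the smaller ball. -/
lemma mul_volume_le_of_heat_le (hφc : Continuous φ) (hφ : ∀ x, 0 ≤ φ x) {M : ℝ}
    (hM : ∀ x, φ x ≤ M) {σ c : ℝ} (hσ : 0 ≤ σ) (hc : ∀ x, heat σ φ x ≤ c)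
    (k : ℝ) (r : ℝ) (x₀ : RSpace n) :
    (stdGaussian (RSpace n)).real (Metric.closedBall 0 k) *
        (α * volume.real (Metric.ball x₀ r ∩ {y | α ≤ φ y})) ≤
      c * volume.real (Metric.ball x₀ (r + σ * k)) := by
  have hfin : IsFiniteMeasure
      ((volume : Measure (RSpace n)).restrict (Metric.ball x₀ (r + σ * k))) :=
    ⟨by simpa using measure_ball_lt_top⟩
  have hint : Integrable (fun q : RSpace n × RSpace n => φ (q.1 + σ • q.2))
      (((volume : Measure (RSpace n)).restrict (Metric.ball x₀ (r + σ * k))).prod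
        (stdGaussian (RSpace n))) := by
    refine Integrable.of_bound (Continuous.aestronglyMeasurable (by fun_prop)) M
      (ae_of_all _ fun x => ?_)
    rw [Real.norm_of_nonneg (hφ _)]
    exact hM _
  have h1 : ∫ x in Metric.ball x₀ (r + σ * k), heat σ φ x ≤
      c * volume.real (Metric.ball x₀ (r + σ * k)) := by
    have := setIntegral_mono_on (μ := volume) (s := Metric.ball x₀ (r + σ * k))
      hint.integral_prod_left (integrable_const c) measurableSet_ball fun x _ => hc x
    refine this.trans (le_of_eq ?_)
    rw [setIntegral_const, smul_eq_mul, mul_comm]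
  have h2 : ∫ x in Metric.ball x₀ (r + σ * k), heat σ φ x =
      ∫ z, (∫ x in Metric.ball x₀ (r + σ * k), φ (x + σ • z)) ∂(stdGaussian (RSpace n)) :=
    integral_integral_swap (f := fun x z => φ (x + σ • z)) hint
  rw [h2] at h1
  refine le_trans ?_ h1
  have hint2 : Integrable (fun z => ∫ x in Metric.ball x₀ (r + σ * k), φ (x + σ • z))
      (stdGaussian (RSpace n)) := hint.integral_prod_right
  have h3 : ∫ z in Metric.closedBall 0 k, (α * volume.real (Metric.ball x₀ r ∩ {y | α ≤ φ y}))
      ∂(stdGaussian (RSpace n)) ≤ ∫ z in Metric.closedBall 0 k,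
        (∫ x in Metric.ball x₀ (r + σ * k), φ (x + σ • z)) ∂(stdGaussian (RSpace n)) := by
    refine setIntegral_mono_on (integrable_const _) hint2.integrableOn
      Metric.isClosed_closedBall.measurableSet fun z hz => ?_
    refine le_setIntegral_translate hφc hφ hM ?_ x₀
    rw [norm_smul, Real.norm_of_nonneg hσ]
    have : ‖z‖ ≤ k := by simpa using hz
    gcongr
  rw [setIntegral_const, smul_eq_mul] at h3
  exact h3.trans (setIntegral_le_integral hint2
    (ae_of_all _ fun z => integral_nonneg fun x => hφ _))

lemma tendsto_stdGaussian_closedBall :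
    Tendsto (fun k : ℕ => (stdGaussian (RSpace n)).real (Metric.closedBall 0 k)) atTop (𝓝 1) := by
  have h1 := tendsto_measure_iUnion_atTop (μ := stdGaussian (RSpace n))
    (s := fun k : ℕ => Metric.closedBall (0 : RSpace n) k)
    (fun i j hij => Metric.closedBall_subset_closedBall (by exact_mod_cast hij))
  rw [Metric.iUnion_closedBall_nat, measure_univ] at h1
  have h2 := (ENNReal.tendsto_toReal ENNReal.one_ne_top).comp h1
  simpa [Function.comp_def, measureReal_def] using h2

/-- The supremum of the heat evolution dominates `α` times the upper density at infinity of
`{φ ≥ α}`. -/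
theorem mul_upperDensity_le_of_heat_le (hφc : Continuous φ) (hφ : ∀ x, 0 ≤ φ x) {M : ℝ}
    (hM : ∀ x, φ x ≤ M) (hα : 0 < α) {σ c : ℝ} (hσ : 0 ≤ σ) (hc : ∀ x, heat σ φ x ≤ c) :
    α * upperDensity φ α ≤ c := by
  have hk : ∀ k : ℕ, (stdGaussian (RSpace n)).real (Metric.closedBall 0 k) *
      (α * upperDensity φ α) ≤ c := by
    intro k
    set g := (stdGaussian (RSpace n)).real (Metric.closedBall 0 k)
    have hg : 0 ≤ g := measureReal_nonneg
    have hc0 : 0 ≤ c := (integral_nonneg fun z => hφ _).trans (hc 0)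
    rcases hg.eq_or_lt with h0 | hgpos
    · rw [← h0, zero_mul]
      exact hc0
    -- For fixed `k` the ratio of ball volumes tends to `1` as `r → ∞`; only afterwards does `k → ∞`
    -- send the Gaussian mass `g` to `1`.
    have hbound : ∀ r > 0, density φ α r ≤ c / (g * α) * ((r + σ * k) / r) ^ n := by
      intro r hr
      refine ciSup_le fun x => ?_
      have h1 := mul_volume_le_of_heat_le (α := α) hφc hφ hM hσ hc k r x
      have hV : ∀ ρ > 0, volume.real (Metric.ball x ρ) =
          ρ ^ n * volume.real (Metric.ball (0 : RSpace n) 1) := by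
        intro ρ hρ
        rw [measureReal_def, Measure.addHaar_ball_of_pos _ _ hρ, ENNReal.toReal_mul,
          ENNReal.toReal_ofReal (by positivity), finrank_euclideanSpace_fin, measureReal_def]
      have hV1 : 0 < volume.real (Metric.ball (0 : RSpace n) 1) :=
        ENNReal.toReal_pos (Metric.measure_ball_pos _ _ one_pos).ne' measure_ball_lt_top.ne
      have hr' : 0 < r + σ * k := by positivity
      rw [hV _ hr'] at h1
      rw [hV r hr, div_le_iff₀ (by positivity), div_pow]
      have h2 : c / (g * α) * ((r + σ * k) ^ n / r ^ n) *
          (r ^ n * volume.real (Metric.ball (0 : RSpace n) 1)) =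
          c * ((r + σ * k) ^ n * volume.real (Metric.ball (0 : RSpace n) 1)) / (g * α) := by
        field_simp
      rw [h2, le_div_iff₀ (by positivity)]
      linarith
    have hlim : Tendsto (fun r : ℝ => c / (g * α) * ((r + σ * k) / r) ^ n) atTop
        (𝓝 (c / (g * α))) := by
      have h1 : Tendsto (fun r : ℝ => 1 + σ * k * r⁻¹) atTop (𝓝 1) := by
        simpa using (tendsto_inv_atTop_zero.const_mul (σ * k)).const_add (1 : ℝ)
      have h2 : Tendsto (fun r : ℝ => (r + σ * k) / r) atTop (𝓝 1) := by
        refine h1.congr' ?_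
        filter_upwards [eventually_gt_atTop 0] with r hr
        field_simp
      simpa using (h2.pow n).const_mul (c / (g * α))
    have h1 : upperDensity φ α ≤ c / (g * α) := by
      rw [← hlim.limsup_eq]
      refine limsup_le_limsup ?_ ?_ ?_
      · filter_upwards [eventually_gt_atTop 0] with r hr using hbound r hr
      · exact isCoboundedUnder_le_of_le _ (x := 0) fun r => density_nonneg r
      · exact hlim.isBoundedUnder_le
    rw [le_div_iff₀ (by positivity)] at h1
    linarith
  have h1 := (tendsto_stdGaussian_closedBall (n := n)).mul_const (α * upperDensity φ α)
  rw [one_mul] at h1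
  exact le_of_tendsto' h1 hk

end Density

/-! ### The life span bound and the maximal solution. -/

section Main

variable {n : ℕ} {p : ℝ} {φ : RSpace n → ℝ} {α : ℝ}

lemma IsClassicalSolution.le_lifeSpan_bound (hp : 1 < p) (hφ_cont : Continuous φ)
    (hφ : ∀ x, 0 ≤ φ x) {M : ℝ} (hM : ∀ x, φ x ≤ M) (hα : 0 < α) (hD : 0 < upperDensity φ α)
    {S : ℝ} {v : ℝ → RSpace n → ℝ} (hv : IsClassicalSolution p φ S v) :
    S ≤ 1 / (p - 1) * (α * upperDensity φ α) ^ (1 - p) := by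
  have hp1 : 0 < p - 1 := by linarith
  have hA : 0 < α * upperDensity φ α := mul_pos hα hD
  have hpos : 0 < (α * upperDensity φ α) ^ (1 - p) := Real.rpow_pos_of_pos hA _
  refine le_of_forall_lt fun τ hτS => ?_
  rcases le_or_gt τ 0 with hτ | hτ
  · exact hτ.trans_lt (by positivity)
  -- The intermediate time supplies the strict inequality demanded by `le_of_forall_lt`.
  obtain ⟨τ', hτ1, hτ2⟩ := exists_between hτS
  have hτ'0 : 0 < τ' := hτ.trans hτ1
  -- This is the level with `m^(1-p) = (p-1)τ'`; a value of `S(τ')φ` above it would contradict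
  -- `mul_le_heat_rpow`.
  set m : ℝ := ((p - 1) * τ') ^ (1 - p)⁻¹
  have hm : 0 < m := Real.rpow_pos_of_pos (by positivity) _
  have hmp : m ^ (1 - p) = (p - 1) * τ' :=
    Real.rpow_inv_rpow (by positivity) (by linarith)
  have hheat : ∀ x, heat (√(2 * τ')) φ x ≤ m := by
    intro x
    by_contra! hlt
    have h1 := hv.mul_le_heat_rpow hp hφ ⟨hτ'0, hτ2⟩ (hm.trans hlt)
    have h2 := Real.rpow_lt_rpow_of_neg hm hlt (by linarith : 1 - p < 0)
    rw [hmp] at h2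
    linarith
  have h1 := mul_upperDensity_le_of_heat_le hφ_cont hφ hM hα (Real.sqrt_nonneg _) hheat
  have h2 := Real.rpow_le_rpow_of_nonpos hA h1 (by linarith : 1 - p ≤ 0)
  rw [hmp] at h2
  refine hτ1.trans_le ?_
  rw [one_div, ← div_eq_inv_mul, le_div_iff₀ hp1]
  linarith

/-- For continuous `g` the set where the bound fails is open and null, hence empty. -/
lemma abs_le_of_eLpNorm_top_le {g : RSpace n → ℝ} (hg : Continuous g) {M : NNReal}
    (h : eLpNorm g ⊤ volume ≤ M) (x : RSpace n) : |g x| ≤ M := by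
  by_contra! hlt
  have hopen : IsOpen {y | (M : ℝ) < |g y|} := isOpen_lt continuous_const hg.abs
  have hzero : volume {y | (M : ℝ) < |g y|} = 0 := by
    have h1 : ∀ᵐ y, ¬ (M : ℝ) < |g y| := by
      filter_upwards [ae_le_eLpNormEssSup (f := g) (μ := volume)] with y hy
      rw [← eLpNorm_exponent_top] at hy
      have h2 : (‖g y‖₊ : ENNReal) ≤ M := hy.trans h
      have h3 : ‖g y‖₊ ≤ M := by exact_mod_cast h2
      rw [not_lt, ← Real.norm_eq_abs]
      exact h3
    simpa [ae_iff] using h1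
  rw [hopen.measure_eq_zero_iff (μ := volume)] at hzero
  have hx : x ∈ {y | (M : ℝ) < |g y|} := hlt
  rw [hzero] at hx
  exact hx

end Main

theorem theorem2 (n : ℕ) (hn : 1 ≤ n) (p : ℝ) (hp : 1 < p)
    (φ : RSpace n → ℝ) (hφ_cont : Continuous φ) (hφ_nonneg : ∀ x, 0 ≤ φ x)
    (hφ_bdd : ∃ M : ℝ, ∀ x, φ x ≤ M) (hφ_ne : ∃ x, φ x ≠ 0)
    (α : ℝ) (hα : 0 < α) (hD : 0 < upperDensity φ α) :
    ∃ (T : ℝ) (u : ℝ → RSpace n → ℝ),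
      0 < T ∧
      IsClassicalSolution p φ T u ∧
      -- `u` is the unique maximal solution, so `T` is the life span
      (∀ (S : ℝ) (v : ℝ → RSpace n → ℝ), IsClassicalSolution p φ S v →
        S ≤ T ∧ ∀ t ∈ Ico 0 S, ∀ x, v t x = u t x) ∧
      -- blow-up of the sup norm at time `T`
      Tendsto (fun t => eLpNorm (u t) ⊤ volume) (𝓝[<] T) (𝓝 ⊤) ∧
      T ≤ 1 / (p - 1) * (α * upperDensity φ α) ^ (1 - p) := by
  classical
  obtain ⟨M, hM⟩ := hφ_bdd
  have hbound : ∀ S v, IsClassicalSolution p φ S v →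
      S ≤ 1 / (p - 1) * (α * upperDensity φ α) ^ (1 - p) := fun S v hv =>
    hv.le_lifeSpan_bound hp hφ_cont hφ_nonneg hM hα hD
  set A : Set ℝ := {S | 0 < S ∧ ∃ v, IsClassicalSolution p φ S v}
  have hne : A.Nonempty := by
    have hM1 : ∀ x, |φ x| ≤ max M 1 := fun x => by
      rw [abs_of_nonneg (hφ_nonneg x)]
      exact (hM x).trans (le_max_left _ _)
    obtain ⟨δ, hδ, hex⟩ := exists_isMildSolution (E := RSpace n) hp
      (lt_of_lt_of_le one_pos (le_max_right M 1))
    obtain ⟨v, hv⟩ := hex φ hφ_cont hM1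
    exact ⟨δ, hδ, v, hv.isClassicalSolution hp hφ_cont hM1 hδ⟩
  have hbdd : BddAbove A := ⟨_, fun S hS => hbound S _ hS.2.choose_spec⟩
  set T : ℝ := sSup A
  have hleT : ∀ S v, IsClassicalSolution p φ S v → 0 < S → S ≤ T := fun S v hv hS =>
    le_csSup hbdd ⟨hS, v, hv⟩
  have hT : 0 < T := by
    obtain ⟨S, hS, v, hv⟩ := hne
    exact hS.trans_le (hleT S v hv hS)
  -- At each time any solution living longer may be chosen, because uniqueness makes all choices
  -- agree; the value `0` is a default when there is none.
  let u : ℝ → RSpace n → ℝ := fun t =>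
    if h : ∃ S v, IsClassicalSolution p φ S v ∧ t < S then h.choose_spec.choose t else 0
  have hu : ∀ S v, IsClassicalSolution p φ S v → ∀ t ∈ Ico 0 S, u t = v t := by
    intro S v hv t ht
    have h : ∃ S v, IsClassicalSolution p φ S v ∧ t < S := ⟨S, v, hv, ht.2⟩
    have h1 : u t = h.choose_spec.choose t := dif_pos h
    rw [h1]
    have h2 := h.choose_spec.choose_spec
    exact h2.1.eq_of_mem hp hv ht.1 h2.2 ht.2
  have hcl : IsClassicalSolution p φ T u := by
    obtain ⟨S₀, hS₀, v₀, hv₀⟩ := id hne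
    refine IsClassicalSolution.of_local (fun x => ?_) (fun T' hT' => ?_) (fun x => ?_)
      fun t ht => ?_
    · rw [hu S₀ v₀ hv₀ 0 ⟨le_rfl, hS₀⟩, hv₀.initial]
    · obtain ⟨S, ⟨-, v, hv⟩, hS⟩ := exists_lt_of_lt_csSup hne hT'
      obtain ⟨K, hK⟩ := hv.bounded T' hS
      refine ⟨K, fun t ht x => ?_⟩
      rw [hu S v hv t ⟨ht.1, ht.2.trans_lt hS⟩]
      exact hK t ht x
    · have hnear : ∀ᶠ z : ℝ × RSpace n in 𝓝[Ico 0 T ×ˢ univ] (0, x), z.1 ∈ Ico 0 S₀ := by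
        have h1 : ∀ᶠ z : ℝ × RSpace n in 𝓝 (0, x), z.1 < S₀ :=
          continuousAt_fst.eventually (gt_mem_nhds hS₀)
        filter_upwards [self_mem_nhdsWithin, nhdsWithin_le_nhds h1] with z hz hz'
        exact ⟨hz.1.1, hz'⟩
      have h1 : ContinuousWithinAt (fun z : ℝ × RSpace n => v₀ z.1 z.2) (Ico 0 T ×ˢ univ) (0, x) :=
        (hv₀.continuousOn (0, x) ⟨⟨le_rfl, hS₀⟩, mem_univ _⟩).mono_of_mem_nhdsWithin
          (hnear.mono fun z hz => ⟨hz, mem_univ _⟩)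
      refine h1.congr_of_eventuallyEq ?_ (by rw [hu S₀ v₀ hv₀ 0 ⟨le_rfl, hS₀⟩])
      filter_upwards [hnear] with z hz
      rw [hu S₀ v₀ hv₀ z.1 hz]
    · obtain ⟨S, ⟨-, v, hv⟩, hS⟩ := exists_lt_of_lt_csSup hne ht.2
      refine ⟨φ, S, v, 0, hv, by simpa using ⟨ht.1, hS⟩, ?_⟩
      filter_upwards [Ioo_mem_nhds ht.1 hS] with s hs
      rw [hu S v hv s ⟨hs.1.le, hs.2⟩, sub_zero]
  refine ⟨T, u, hT, hcl, fun S v hv => ⟨?_, fun t ht x => ?_⟩, ?_, hbound T u hcl⟩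
  · rcases le_or_gt S 0 with h | h
    · exact h.trans hT.le
    · exact hleT S v hv h
  · rw [hu S v hv t ht]
  · rw [ENNReal.tendsto_nhds_top_iff_nnreal]
    intro K
    -- If the norm were at most `K` at some `t > T - δ`, a restart at `t` would live beyond `T`,
    -- against maximality. As this holds for every such `t`, the norm has limit `∞`. The bound `K +
    -- 1` is used because `K` may vanish.
    obtain ⟨δ, hδ, hex⟩ := exists_isMildSolution (E := RSpace n) hp
      (by positivity : (0 : ℝ) < K + 1)
    filter_upwards [Ioo_mem_nhdsLT (max_lt hT (sub_lt_self T hδ))] with t ht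
    by_contra! hle
    have ht0 : 0 < t := (le_max_left _ _).trans_lt ht.1
    have htδ : T < t + δ := by
      have := (le_max_right _ _).trans_lt ht.1
      linarith
    have hcont := hcl.continuous_apply ⟨ht0.le, ht.2⟩
    have habs : ∀ x, |u t x| ≤ K + 1 := fun x =>
      (abs_le_of_eLpNorm_top_le hcont hle x).trans (by linarith)
    obtain ⟨v, hv⟩ := hex (u t) hcont habs
    obtain ⟨w, hw⟩ := hcl.exists_extension hp ⟨ht0, ht.2⟩
      (hv.isClassicalSolution hp hcont habs hδ) htδ
    exact absurd (hleT _ w hw (by linarith)) (not_le.2 htδ)
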